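/- Let $\nu$ be a finite Borel measure on $(0,1)$ and let $\Lambda$ denote Lebesgue measure. Let $H_0^1(0,1)$ be the space of functions $f:[0,1]\to\mathbb R$ with $f(0)=f(1)=0$ for which there is $\nabla f\in L^2_\Lambda([0,1])$ with $f(x)=f(0)+\int_0^x\nabla f\,d\Lambda$ for all $x\in[0,1]$. Let $\operatorname{dom}(\mathcal E_\nu)$ be the set of all $f\in H_0^1(0,1)$ that are affine linear on each connected component of $[0,1]\setminus\operatorname{supp}\nu$, and set $\mathcal E_\nu(f,g)=\int_0^1\nabla f\,\nabla g\,d\Lambda$ for $f,g\in\operatorname{dom}(\mathcal E_\nu)$. A real number $\lambda$ is an eigenvalue of $\mathcal E_\nu$ if there is $f\in\operatorname{dom}(\mathcal E_\nu)\setminus\{0\}$ with $\mathcal E_\nu(f,g)=\lambda\int fg\,d\nu$ for all $g\in\operatorname{dom}(\mathcal E_\nu)$. Let $N_\nu(x)$ be the number of eigenvalues not exceeding $x$, counted with multiplicity, and define the lower and upper spectral dimension of $\nu$ by $$\underline s_\nu=\liminf_{x\to\infty}\frac{\log N_\nu(x)}{\log x},\qquad \overline s_\nu=\limsup_{x\to\infty}\frac{\log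 N_\nu(x)}{\log x}.$$ If they coincide, the common value is denoted by $s_\nu$ and the spectral dimension is said to exist. For $q\in\mathbb R$ the $L^q$-spectrum of $\nu$ is $$\beta_\nu(q)=\limsup_{n\to\infty}\beta_n^\nu(q),\qquad \beta_n^\nu(q)=\frac1{\log 2^n}\log\sum_{C\in\mathcal D_{\nu,n}}\nu(C)^q,$$ where $\mathcal D_{\nu,n}$ is the set of those intervals $((k-1)2^{-n},k2^{-n}]$, $1\le k\le 2^n$, that have positive $\nu$-measure. (Logarithms, limits superior and limits inferior are taken in $[-\infty,\infty]$, with $\log 0=-\infty$.) Then the following hold. 1. If $\overline s_\nu=1/2$, then $\beta_\nu(q)=1-q$ for all $q\in[0,1]$. 2. If for some $q\in(0,1)$ the limit $\lim_{n\to\infty}\beta_n^\nu(q)$ exists and $\beta_\nu(q)=\lim_{n\to\infty}\beta_n^\nu(q)=1-q$, then $\beta_\nu(p)=1-p$ for all $p\in[0,1]$, and the spectral dimension exists with $s_\nu=1/2$. -/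

import Mathlib

open MeasureTheory Set Filter
open scoped Topology ENNReal

noncomputable section

namespace KreinFeller

/-! ### The Sobolev space on `[0,1]`

A function on `[0,1]` that vanishes at both endpoints is represented by its extension by zero to
the whole real line. -/

/-- `u` is a weak derivative of `f` on `[0,1]`: it is square integrable on `[0,1]` with respect
to Lebesgue measure and `f x = f 0 + ∫_0^x u` for `x ∈ [0,1]`. -/
def IsWeakDeriv (f u : ℝ → ℝ) : Prop :=
  MemLp u 2 (volume.restrict (Icc 0 1)) ∧
    ∀ x ∈ Icc (0 : ℝ) 1, f x = f 0 + ∫ t in (0 : ℝ)..x, u t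

theorem IsWeakDeriv.intervalIntegrable {f u : ℝ → ℝ} (h : IsWeakDeriv f u) {x : ℝ}
    (hx : x ∈ Icc (0 : ℝ) 1) : IntervalIntegrable u volume 0 x := by
  have h1 : IntegrableOn u (Icc 0 1) := h.1.integrable (by norm_num)
  rw [intervalIntegrable_iff_integrableOn_Icc_of_le hx.1]
  exact h1.mono_set (Icc_subset_Icc_right hx.2)

theorem IsWeakDeriv.add {f g u v : ℝ → ℝ} (hf : IsWeakDeriv f u) (hg : IsWeakDeriv g v) :
    IsWeakDeriv (f + g) (u + v) := by
  refine ⟨hf.1.add hg.1, fun x hx => ?_⟩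
  have := intervalIntegral.integral_add (hf.intervalIntegrable hx) (hg.intervalIntegrable hx)
  simp only [Pi.add_apply, this, hf.2 x hx, hg.2 x hx]
  ring

theorem IsWeakDeriv.smul {f u : ℝ → ℝ} (c : ℝ) (hf : IsWeakDeriv f u) :
    IsWeakDeriv (c • f) (c • u) := by
  refine ⟨hf.1.const_smul c, fun x hx => ?_⟩
  simp only [Pi.smul_apply, smul_eq_mul, intervalIntegral.integral_const_mul, hf.2 x hx]
  ring

theorem IsWeakDeriv.zero : IsWeakDeriv 0 0 :=
  ⟨MemLp.zero, fun x _ => by simp⟩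

theorem IsWeakDeriv.continuousOn {f u : ℝ → ℝ} (h : IsWeakDeriv f u) :
    ContinuousOn f (Icc 0 1) := by
  have h1 : IntegrableOn u (Icc 0 1) := h.1.integrable (by norm_num)
  have h2 := intervalIntegral.continuousOn_primitive_interval (a := (0 : ℝ)) (b := 1) (f := u)
    (μ := volume) (by rwa [uIcc_of_le zero_le_one])
  rw [uIcc_of_le zero_le_one] at h2
  exact (continuousOn_const.add h2).congr h.2

theorem IsWeakDeriv.ae_unique {f u v : ℝ → ℝ} (hu : IsWeakDeriv f u) (hv : IsWeakDeriv f v) :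
    u =ᵐ[volume.restrict (Icc 0 1)] v := by
  have h01 : (1 : ℝ) ∈ Icc (0 : ℝ) 1 := by simp
  have hU := (hu.intervalIntegrable h01).ae_hasDerivAt_integral
  have hV := (hv.intervalIntegrable h01).ae_hasDerivAt_integral
  rw [Filter.EventuallyEq, ← restrict_Ioo_eq_restrict_Icc, ae_restrict_iff' measurableSet_Ioo]
  filter_upwards [hU, hV] with x hxU hxV hx
  have hx' : x ∈ uIcc (0 : ℝ) 1 := by
    rw [uIcc_of_le zero_le_one]; exact Ioo_subset_Icc_self hx
  have h0 : (0 : ℝ) ∈ uIcc (0 : ℝ) 1 := by simp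
  refine (hxU hx' 0 h0).unique ((hxV hx' 0 h0).congr_of_eventuallyEq ?_)
  filter_upwards [Ioo_mem_nhds hx.1 hx.2] with y hy
  have := hu.2 y (Ioo_subset_Icc_self hy)
  have := hv.2 y (Ioo_subset_Icc_self hy)
  linarith

open Classical in
/-- The weak derivative of `f` on `[0,1]`, which is unique up to a Lebesgue null set
(and `0` if there is none). -/
def weakDeriv (f : ℝ → ℝ) : ℝ → ℝ :=
  if h : ∃ u, IsWeakDeriv f u then h.choose else 0

theorem isWeakDeriv_weakDeriv {f : ℝ → ℝ} (h : ∃ u, IsWeakDeriv f u) :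
    IsWeakDeriv f (weakDeriv f) := by
  rw [weakDeriv, dif_pos h]; exact h.choose_spec

/-- The Sobolev space `H_0^1(0,1)`. -/
def H10 : Submodule ℝ (ℝ → ℝ) where
  carrier := {f | (∀ x ∉ Ioo (0 : ℝ) 1, f x = 0) ∧ ∃ u, IsWeakDeriv f u}
  zero_mem' := ⟨fun _ _ => rfl, 0, IsWeakDeriv.zero⟩
  add_mem' := by
    rintro f g ⟨hf, u, hu⟩ ⟨hg, v, hv⟩
    exact ⟨fun x hx => by simp [hf x hx, hg x hx], u + v, hu.add hv⟩
  smul_mem' := by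
    rintro c f ⟨hf, u, hu⟩
    exact ⟨fun x hx => by simp [hf x hx], c • u, hu.smul c⟩

/-- `C_ν([0,1])`: the functions that are continuous on `[0,1]` and affine linear on each
connected component of `[0,1] \ supp ν`. -/
def CNu (ν : Measure ℝ) : Submodule ℝ (ℝ → ℝ) where
  carrier := {f | ContinuousOn f (Icc 0 1) ∧ ∀ x ∈ Icc (0 : ℝ) 1 \ ν.support,
    ∃ c d : ℝ, ∀ y ∈ connectedComponentIn (Icc (0 : ℝ) 1 \ ν.support) x, f y = c * y + d}
  zero_mem' := ⟨continuousOn_const, fun _ _ => ⟨0, 0, fun _ _ => by simp⟩⟩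
  add_mem' := by
    rintro f g ⟨hf, hf'⟩ ⟨hg, hg'⟩
    refine ⟨hf.add hg, fun x hx => ?_⟩
    obtain ⟨c, d, h⟩ := hf' x hx
    obtain ⟨c', d', h'⟩ := hg' x hx
    exact ⟨c + c', d + d', fun y hy => by simp only [Pi.add_apply, h y hy, h' y hy]; ring⟩
  smul_mem' := by
    rintro a f ⟨hf, hf'⟩
    refine ⟨hf.const_smul a, fun x hx => ?_⟩
    obtain ⟨c, d, h⟩ := hf' x hx
    exact ⟨a * c, a * d, fun y hy => by
      simp only [Pi.smul_apply, smul_eq_mul, h y hy]; ring⟩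

/-! ### The form and its eigenvalues -/

/-- The domain `H_0^1(0,1) ∩ C_ν([0,1])` of the Dirichlet form. -/
def formDomain (ν : Measure ℝ) : Submodule ℝ (ℝ → ℝ) := H10 ⊓ CNu ν

/-- The form `(f, g) ↦ ∫_0^1 ∇f ∇g`. -/
def energy (f g : ℝ → ℝ) : ℝ := ∫ t in (0 : ℝ)..1, weakDeriv f t * weakDeriv g t

/-- The inner product of `L²(ν)`. -/
def innerNu (ν : Measure ℝ) (f g : ℝ → ℝ) : ℝ := ∫ t, f t * g t ∂ν

/-- The energy can be computed from arbitrary weak derivatives. -/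
theorem energy_eq {f g u v : ℝ → ℝ} (hu : IsWeakDeriv f u) (hv : IsWeakDeriv g v) :
    energy f g = ∫ t in (0 : ℝ)..1, u t * v t := by
  have h1 := (isWeakDeriv_weakDeriv ⟨u, hu⟩).ae_unique hu
  have h2 := (isWeakDeriv_weakDeriv ⟨v, hv⟩).ae_unique hv
  rw [energy, intervalIntegral.integral_of_le zero_le_one,
    intervalIntegral.integral_of_le zero_le_one, ← integral_Icc_eq_integral_Ioc,
    ← integral_Icc_eq_integral_Ioc]
  exact integral_congr_ae (h1.mul h2)

theorem IsWeakDeriv.mul_intervalIntegrable {f g u v : ℝ → ℝ} (hu : IsWeakDeriv f u)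
    (hv : IsWeakDeriv g v) : IntervalIntegrable (fun t => u t * v t) volume 0 1 := by
  rw [intervalIntegrable_iff_integrableOn_Icc_of_le zero_le_one]
  exact hu.1.integrable_mul hv.1

theorem energy_add_left {f f' g : ℝ → ℝ} (hf : f ∈ H10) (hf' : f' ∈ H10) (hg : g ∈ H10) :
    energy (f + f') g = energy f g + energy f' g := by
  obtain ⟨-, u, hu⟩ := hf
  obtain ⟨-, u', hu'⟩ := hf'
  obtain ⟨-, v, hv⟩ := hg
  rw [energy_eq (hu.add hu') hv, energy_eq hu hv, energy_eq hu' hv,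
    ← intervalIntegral.integral_add (hu.mul_intervalIntegrable hv)
      (hu'.mul_intervalIntegrable hv)]
  simp only [Pi.add_apply, add_mul]

theorem energy_smul_left {f g : ℝ → ℝ} (c : ℝ) (hf : f ∈ H10) (hg : g ∈ H10) :
    energy (c • f) g = c * energy f g := by
  obtain ⟨-, u, hu⟩ := hf
  obtain ⟨-, v, hv⟩ := hg
  rw [energy_eq (hu.smul c) hv, energy_eq hu hv, ← intervalIntegral.integral_const_mul]
  simp only [Pi.smul_apply, smul_eq_mul, mul_assoc]

theorem integrable_mul (ν : Measure ℝ) [IsFiniteMeasure ν] {f g : ℝ → ℝ}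
    (hf : f ∈ H10) (hg : g ∈ H10) : Integrable (fun t => f t * g t) ν := by
  obtain ⟨hf0, u, hu⟩ := hf
  obtain ⟨-, v, hv⟩ := hg
  have h : IntegrableOn (fun t => f t * g t) (Icc 0 1) ν :=
    (hu.continuousOn.mul hv.continuousOn).integrableOn_compact isCompact_Icc
  refine (integrableOn_iff_integrable_of_support_subset fun x hx => ?_).1 h
  by_contra hx'
  exact hx (by simp [hf0 x fun h => hx' (Ioo_subset_Icc_self h)])

/-- The space of all `f` in the domain with `E(f, g) = lam ⟨f, g⟩_ν` for all `g` in the domain;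
its nonzero elements are the eigenfunctions with eigenvalue `lam`. -/
def eigenspace (ν : Measure ℝ) [IsFiniteMeasure ν] (lam : ℝ) : Submodule ℝ (ℝ → ℝ) where
  carrier := {f | f ∈ formDomain ν ∧
    ∀ g ∈ formDomain ν, energy f g = lam * innerNu ν f g}
  zero_mem' := ⟨zero_mem _, fun g hg => by
    have := energy_smul_left 0 (zero_mem H10) hg.1
    simpa [innerNu] using this⟩
  add_mem' := by
    rintro f f' ⟨hf, h⟩ ⟨hf', h'⟩
    refine ⟨add_mem hf hf', fun g hg => ?_⟩
    have : innerNu ν (f + f') g = innerNu ν f g + innerNu ν f' g := by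
      simp only [innerNu, Pi.add_apply, add_mul]
      exact integral_add (integrable_mul ν hf.1 hg.1) (integrable_mul ν hf'.1 hg.1)
    rw [energy_add_left hf.1 hf'.1 hg.1, h g hg, h' g hg, this]
    ring
  smul_mem' := by
    rintro c f ⟨hf, h⟩
    refine ⟨Submodule.smul_mem _ c hf, fun g hg => ?_⟩
    have : innerNu ν (c • f) g = c * innerNu ν f g := by
      simp only [innerNu, Pi.smul_apply, smul_eq_mul, mul_assoc]
      exact integral_const_mul c _
    rw [energy_smul_left c hf.1 hg.1, h g hg, this]
    ring

/-- The multiplicity of `lam` (`0` if `lam` is not an eigenvalue). -/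
def multiplicity (ν : Measure ℝ) [IsFiniteMeasure ν] (lam : ℝ) : ℕ∞ :=
  Cardinal.toENat (Module.rank ℝ (eigenspace ν lam))

/-- The eigenvalue counting function: the number of eigenvalues not exceeding `x`, counted with
multiplicity. -/
def countingFunction (ν : Measure ℝ) [IsFiniteMeasure ν] (x : ℝ) : ℝ≥0∞ :=
  ∑' lam : Iic x, (multiplicity ν lam : ℝ≥0∞)

/-! ### Spectral dimensions

All logarithms and limits are taken in the extended real line, with `log 0 = -∞`. -/

/-- The lower spectral dimension. -/
def lowerSpectralDim (ν : Measure ℝ) [IsFiniteMeasure ν] : EReal :=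
  liminf (fun x : ℝ => ENNReal.log (countingFunction ν x) / (Real.log x : EReal)) atTop

/-- The upper spectral dimension. -/
def upperSpectralDim (ν : Measure ℝ) [IsFiniteMeasure ν] : EReal :=
  limsup (fun x : ℝ => ENNReal.log (countingFunction ν x) / (Real.log x : EReal)) atTop

/-- The spectral dimension of `ν` exists and equals `s`. -/
def HasSpectralDim (ν : Measure ℝ) [IsFiniteMeasure ν] (s : EReal) : Prop :=
  lowerSpectralDim ν = s ∧ upperSpectralDim ν = s

/-! ### The `L^q`-spectrum -/

/-- The dyadic interval `(k 2⁻ⁿ, (k+1) 2⁻ⁿ]`. -/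
def dyadic (n k : ℕ) : Set ℝ := Ioc ((k : ℝ) / 2 ^ n) (((k : ℝ) + 1) / 2 ^ n)

open Classical in
/-- `β_n(q)`; the sum runs over the dyadic intervals of level `n` in `(0,1]` that have positive
`ν`-measure. -/
def lqLevel (ν : Measure ℝ) (n : ℕ) (q : ℝ) : EReal :=
  ENNReal.log (∑ k ∈ (Finset.range (2 ^ n)).filter fun k => 0 < ν (dyadic n k),
    ν (dyadic n k) ^ q) / (Real.log (2 ^ n) : EReal)

/-- The `L^q`-spectrum `β_ν(q) = limsup_n β_n(q)`. -/
def lqSpectrum (ν : Measure ℝ) (q : ℝ) : EReal :=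
  limsup (fun n : ℕ => lqLevel ν n q) atTop

end KreinFeller

end

/-! The spectrum is governed by the products `ν(C)|C|` over dyadic intervals `C`.

Upper bound. If `f` in `H10` vanishes at the left endpoints of a partition, then `∫ f² dν` is at
most `max ν(C)|C|` times its energy. Subdivide dyadically until `ν(C)|C| < t = 1/(2x)`. The number
of eigenvalues up to `x` is then at most the number of stopping intervals, which is controlled by
the number of `C` with `ν(C)|C| ≥ t`; Markov's inequality bounds the latter by `t^(-q) ∑ₙ 2^(-nq) ∑
ν(C)^q`. So if the `L^q`-sums grow at a rate `r < q`, the upper spectral dimension is at most `q`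
(`upperSpectralDim_le_of_lqSum_le`). By Hölder the rate is convex in `q` and at most `1 - q` on
`[0,1]`, whence the dimension is at most `1/2`. A rate strictly below `1 - p` at one `p` in `[0,1]`
stays strictly below at every interior point (`HasLqRate.exists_lt`). Near `q = 1/2` this gives an
upper dimension less than `1/2`, which is statement 1 in contrapositive form; it also gives the
first half of statement 2.

Lower bound. If the level-`n` exponents converge to `1 - q`, Hölder shows that for every large `n`
at least `2^(n(1-η))` intervals have mass at least `2^(-n(1+η))`. A third of them, up to two
boundary intervals, carry disjoint trapezoidal bumps of energy `2·2^n` and `ν`-norm squared at least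
the mass, so about `2^(n(1-η))` eigenvalues lie below a constant times `2^(n(2+η))`. Convergence,
rather than a limsup, makes this available at every large scale, and `η → 0` yields exponent `1/2`
(`half_le_lowerSpectralDim`).

The min-max principle behind the lower bound comes from the compact operator `J*J`, where `J` sends
`u` in `L²([0,1])` to the primitive of `u - ∫ u`, viewed in `L²(ν)`. -/

section Spectral

/-! ### Spectral counting for compact symmetric operators on a Hilbert space. -/

open Module.End

variable {K : Type*} [NormedAddCommGroup K] [InnerProductSpace ℝ K] [CompleteSpace K]

open scoped InnerProductSpace

/-- On vectors orthogonal to all eigenspaces of eigenvalues at least `δ`, the quadratic form of a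
compact symmetric operator is bounded by `δ`. -/
theorem inner_apply_le_of_orthogonal_eigenspaces {R : K →L[ℝ] K} (hR : IsCompactOperator R)
    (hs : (R : K →ₗ[ℝ] K).IsSymmetric) {δ : ℝ} {v : K}
    (hv : ∀ μ, δ ≤ μ → ∀ w ∈ eigenspace (R : K →ₗ[ℝ] K) μ, ⟪w, v⟫_ℝ = 0) :
    ⟪R v, v⟫_ℝ ≤ δ * ‖v‖ ^ 2 := by
  set U : Submodule ℝ K := ⨆ μ : Iio δ, eigenspace (R : K →ₗ[ℝ] K) μ with hU
  have hmem : v ∈ U.topologicalClosure := by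
    set Y := U.topologicalClosure with hY
    have : IsComplete (Y : Set K) := U.isClosed_topologicalClosure.isComplete
    have : CompleteSpace Y := completeSpace_coe_iff_isComplete.2 this
    -- The component `w` is orthogonal to the eigenspaces below `δ` by construction, and to the
    -- others because `v` and `u` are. Completeness of the eigenspaces of a compact symmetric
    -- operator then gives `w = 0`.
    obtain ⟨u, hu, w, hw, rfl⟩ := Y.exists_add_mem_mem_orthogonal v
    have horth : ∀ μ, δ ≤ μ → ∀ z ∈ eigenspace (R : K →ₗ[ℝ] K) μ, ⟪z, u⟫_ℝ = 0 := by
      intro μ hμ z hz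
      have hle : U ≤ (ℝ ∙ z)ᗮ := by
        rw [hU, iSup_le_iff]
        intro μ' y hy
        rw [Submodule.mem_orthogonal_singleton_iff_inner_right]
        exact hs.orthogonalFamily_eigenspaces (i := μ) (j := μ')
          (ne_of_gt (lt_of_lt_of_le μ'.2 hμ)) ⟨z, hz⟩ ⟨y, hy⟩
      have := U.topologicalClosure_minimal hle (Submodule.isClosed_orthogonal _) hu
      rwa [Submodule.mem_orthogonal_singleton_iff_inner_right] at this
    have hw0 : w ∈ (⨆ μ, eigenspace (R : K →ₗ[ℝ] K) μ)ᗮ := by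
      rw [← Submodule.iInf_orthogonal, Submodule.mem_iInf]
      intro μ
      rw [Submodule.mem_orthogonal]
      intro z hz
      rcases lt_or_ge μ δ with h | h
      · refine hw z (U.le_topologicalClosure ?_)
        exact Submodule.mem_iSup_of_mem (⟨μ, h⟩ : Iio δ) hz
      · have := hv μ h z hz
        rw [inner_add_right, horth μ h z hz, zero_add] at this
        exact this
    rw [ContinuousLinearMap.orthogonalComplement_iSup_eigenspaces_eq_bot hR hs,
      Submodule.mem_bot] at hw0
    simpa [hw0] using hu
  -- The inequality is a closed condition, so it suffices to check finite sums of eigenvectors with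
  -- eigenvalues below `δ`, where the form is diagonal.
  have hclosed : IsClosed {p : K | ⟪R p, p⟫_ℝ ≤ δ * ‖p‖ ^ 2} :=
    isClosed_le (by fun_prop) (by fun_prop)
  refine closure_minimal ?_ hclosed hmem
  intro p hp
  obtain ⟨f, hf, rfl⟩ := (Submodule.mem_iSup_iff_exists_finsupp _ _).1 hp
  have horth : ∀ i j : Iio δ, i ≠ j → ⟪f i, f j⟫_ℝ = 0 := fun i j hij =>
    hs.orthogonalFamily_eigenspaces (i := (i : ℝ)) (j := j)
      (fun h => hij (Subtype.ext h)) ⟨f i, hf i⟩ ⟨f j, hf j⟩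
  have hRf : ∀ i : Iio δ, R (f i) = (i : ℝ) • f i := fun i => mem_eigenspace_iff.1 (hf i)
  simp only [mem_ofPred_eq, Finsupp.sum, ← real_inner_self_eq_norm_sq, map_sum, sum_inner,
    inner_sum, hRf, inner_smul_left]
  rw [Finset.mul_sum]
  refine Finset.sum_le_sum fun i hi => ?_
  rw [Finset.sum_eq_single_of_mem i hi fun j _ hj => ?_,
    Finset.sum_eq_single_of_mem i hi fun j _ hj => ?_]
  · exact mul_le_mul_of_nonneg_right i.2.le real_inner_self_nonneg
  · rw [horth j i hj]
  · rw [horth j i hj, mul_zero]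

/-- A subspace on which the quadratic form of a compact symmetric operator exceeds `δ` has
dimension at most the number of eigenvalues at least `δ`. -/
theorem natCast_le_tsum_rank_eigenspace {R : K →L[ℝ] K} (hR : IsCompactOperator R)
    (hs : (R : K →ₗ[ℝ] K).IsSymmetric) {δ : ℝ} (hδ : 0 < δ) {m : ℕ} (φ : (Fin m → ℝ) →ₗ[ℝ] K)
    (hφ : ∀ c, c ≠ 0 → δ * ‖φ c‖ ^ 2 < ⟪R (φ c), φ c⟫_ℝ) :
    (m : ℝ≥0∞) ≤ ∑' μ : Ici δ,
      ((Cardinal.toENat (Module.rank ℝ (eigenspace (R : K →ₗ[ℝ] K) μ)) : ℕ∞) : ℝ≥0∞) := by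
  have hfd : ∀ μ : Ici δ, FiniteDimensional ℝ (eigenspace (R : K →ₗ[ℝ] K) μ) := fun μ =>
    ContinuousLinearMap.finite_dimensional_eigenspace hR _ (hδ.trans_le μ.2).ne'
  have hrank : ∀ μ : Ici δ, ((Cardinal.toENat (Module.rank ℝ (eigenspace (R : K →ₗ[ℝ] K) μ)) : ℕ∞)
      : ℝ≥0∞) = (Module.finrank ℝ (eigenspace (R : K →ₗ[ℝ] K) μ) : ℝ≥0∞) := fun μ => by
    rw [← Module.finrank_eq_rank, Cardinal.toENat_nat]; rfl
  simp only [hrank]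
  by_contra! hlt
  -- Multiplicities are integers: a finite sum has finitely many terms that are at least `1`, and
  -- all remaining eigenspaces are trivial.
  have hfin := ENNReal.finite_const_le_of_tsum_ne_top (hlt.ne_top) one_ne_zero
  set S := hfin.toFinset with hS
  have hsum : ∑ μ ∈ S, Module.finrank ℝ (eigenspace (R : K →ₗ[ℝ] K) μ) < m := by
    have := (ENNReal.sum_le_tsum S).trans_lt hlt
    exact_mod_cast this
  -- Projecting onto these eigenspaces lands in dimension less than `m`, so some `c ≠ 0` makes `φ c`
  -- orthogonal to every eigenspace at or above `δ`.
  let Φ : (Fin m → ℝ) →ₗ[ℝ] (∀ μ : S, eigenspace (R : K →ₗ[ℝ] K) ((μ : Ici δ) : ℝ)) :=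
    LinearMap.pi fun μ => by
      have := hfd μ
      exact ((eigenspace (R : K →ₗ[ℝ] K) ((μ : Ici δ) : ℝ)).orthogonalProjectionOnto :
        K →ₗ[ℝ] _) ∘ₗ φ
  have hker : Φ.ker ≠ ⊥ := by
    apply LinearMap.ker_ne_bot_of_finrank_lt
    rw [Module.finrank_pi_fintype, Module.finrank_fin_fun]
    rwa [Finset.sum_coe_sort S fun μ => Module.finrank ℝ (eigenspace (R : K →ₗ[ℝ] K) μ)]
  obtain ⟨c, hc, hc0⟩ := Submodule.exists_mem_ne_zero_of_ne_bot hker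
  refine absurd (inner_apply_le_of_orthogonal_eigenspaces hR hs fun μ hμ w hw => ?_)
    (hφ c hc0).not_ge
  have := hfd ⟨μ, hμ⟩
  by_cases hm : (⟨μ, hμ⟩ : Ici δ) ∈ S
  · have h0 : Φ c ⟨_, hm⟩ = 0 := by rw [LinearMap.mem_ker.1 hc]; rfl
    have h1 : (eigenspace (R : K →ₗ[ℝ] K) μ).orthogonalProjectionOnto (φ c) = 0 := h0
    rw [Submodule.orthogonalProjectionOnto_eq_zero_iff] at h1
    exact h1 w hw
  · have h0 : Module.finrank ℝ (eigenspace (R : K →ₗ[ℝ] K) μ) = 0 := by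
      rw [hS, Set.Finite.mem_toFinset] at hm
      simpa using hm
    rw [Submodule.finrank_eq_zero.1 h0, Submodule.mem_bot] at hw
    rw [hw, inner_zero_left]

/-- A continuous linear map which is arbitrarily small on kernels of finite rank maps is
compact. -/
theorem isCompactOperator_of_forall_small_on_ker {E : Type*} [NormedAddCommGroup E]
    [NormedSpace ℝ E] [CompleteSpace E] {J : K →L[ℝ] E}
    (h : ∀ ε > 0, ∃ (n : ℕ) (B : K →L[ℝ] (Fin n → ℝ)), ∀ u, B u = 0 → ‖J u‖ ≤ ε * ‖u‖) :
    IsCompactOperator J := by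
  have hcl : IsClosed {f : K →L[ℝ] E | IsCompactOperator f} :=
    isClosed_setOfPred_isCompactOperator
  suffices hJ : J ∈ closure {f : K →L[ℝ] E | IsCompactOperator f} by
    rw [hcl.closure_eq] at hJ
    exact hJ
  rw [Metric.mem_closure_iff]
  intro ε hε
  obtain ⟨n, B, hB⟩ := h (ε / 2) (by positivity)
  set Z : Submodule ℝ K := (B : K →ₗ[ℝ] (Fin n → ℝ)).ker with hZ
  have hZc : IsClosed (Z : Set K) := B.isClosed_ker
  have : CompleteSpace Z := completeSpace_coe_iff_isComplete.2 hZc.isComplete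
  have hinj : Function.Injective ((B : K →ₗ[ℝ] (Fin n → ℝ)).domRestrict Zᗮ) := by
    rw [← LinearMap.ker_eq_bot, LinearMap.ker_eq_bot']
    rintro ⟨z, hz⟩ hz0
    have h1 : z ∈ Z := LinearMap.mem_ker.2 hz0
    exact Subtype.ext (inner_self_eq_zero (𝕜 := ℝ).1 (hz z h1))
  have hfd : FiniteDimensional ℝ Zᗮ := FiniteDimensional.of_injective _ hinj
  -- `B` is injective on `Zᗮ`, so this approximant has finite rank; its error is `J` composed with
  -- the projection onto `Z = ker B`.
  refine ⟨(J ∘L Zᗮ.subtypeL) ∘L Zᗮ.orthogonalProjectionOnto, ?_, ?_⟩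
  · exact (isCompactOperator_of_locallyCompactSpace_rng (J ∘L Zᗮ.subtypeL)).comp_clm
      Zᗮ.orthogonalProjectionOnto
  · rw [dist_eq_norm]
    refine lt_of_le_of_lt (ContinuousLinearMap.opNorm_le_bound _ (by positivity) fun u => ?_)
      (half_lt_self hε)
    have h1 : (J - (J ∘L Zᗮ.subtypeL) ∘L Zᗮ.orthogonalProjectionOnto) u =
        J (Z.starProjection u) := by
      have := Z.starProjection_add_starProjection_orthogonal u
      conv_lhs => rw [← this]
      simp
    rw [h1]
    have h2 : B (Z.starProjection u) = 0 :=
      LinearMap.mem_ker.1 (Submodule.starProjection_apply_mem Z u)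
    refine (hB _ h2).trans ?_
    gcongr
    exact Z.norm_starProjection_apply_le u

end Spectral

/-! ### Primitives of `L²` functions and their compact embedding into `L²(ν)`. -/

noncomputable section

namespace KreinFeller

theorem IsWeakDeriv.integrableOn {f u : ℝ → ℝ} (h : IsWeakDeriv f u) :
    IntegrableOn u (Icc 0 1) :=
  h.1.integrable (by norm_num)

theorem IsWeakDeriv.integrableOn_sq {f u : ℝ → ℝ} (h : IsWeakDeriv f u) :
    IntegrableOn (fun t => u t ^ 2) (Icc 0 1) :=
  h.1.integrable_sq

theorem _root_.MeasureTheory.IntegrableOn.intervalIntegrable_of_unit {u : ℝ → ℝ}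
    (hu : IntegrableOn u (Icc 0 1)) {a b : ℝ} (ha : a ∈ Icc (0 : ℝ) 1) (hb : b ∈ Icc (0 : ℝ) 1) :
    IntervalIntegrable u volume a b :=
  (hu.mono_set (uIcc_subset_Icc ha hb)).intervalIntegrable

/-- The Cauchy-Schwarz inequality `(∫ u)² ≤ (b - a) ∫ u²`. -/
theorem sq_integral_le {u : ℝ → ℝ} {a b : ℝ} (hab : a ≤ b) (hu : IntervalIntegrable u volume a b)
    (hu2 : IntervalIntegrable (fun t => u t ^ 2) volume a b) :
    (∫ t in a..b, u t) ^ 2 ≤ (b - a) * ∫ t in a..b, u t ^ 2 := by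
  rcases hab.eq_or_lt with rfl | hlt
  · simp
  set I := ∫ t in a..b, u t with hI
  have hba : 0 < b - a := sub_pos.2 hlt
  -- Nonnegativity of the variance of `u` about its mean over `[a,b]`.
  have h0 : 0 ≤ ∫ t in a..b, (u t - I / (b - a)) ^ 2 :=
    intervalIntegral.integral_nonneg hab fun t _ => sq_nonneg _
  have h1 : ∫ t in a..b, (u t - I / (b - a)) ^ 2 = (∫ t in a..b, u t ^ 2) - I ^ 2 / (b - a) := by
    have : ∀ t, (u t - I / (b - a)) ^ 2 =
        u t ^ 2 - (2 * (I / (b - a))) * u t + (I / (b - a)) ^ 2 := fun t => by ring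
    simp only [this]
    rw [intervalIntegral.integral_add (hu2.sub (hu.const_mul _)) (by simp),
      intervalIntegral.integral_sub hu2 (hu.const_mul _), intervalIntegral.integral_const_mul,
      intervalIntegral.integral_const, ← hI, smul_eq_mul]
    field_simp
    ring
  rw [h1, sub_nonneg, div_le_iff₀ hba] at h0
  linarith

theorem IsWeakDeriv.sub_eq_integral {f u : ℝ → ℝ} (h : IsWeakDeriv f u) {a b : ℝ}
    (ha : a ∈ Icc (0 : ℝ) 1) (hb : b ∈ Icc (0 : ℝ) 1) : f b - f a = ∫ t in a..b, u t := by
  rw [h.2 a ha, h.2 b hb, ← intervalIntegral.integral_interval_sub_left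
    (h.intervalIntegrable hb) (h.intervalIntegrable ha)]
  ring

/-- Functions with a square integrable derivative are Hölder continuous with exponent `1/2`. -/
theorem IsWeakDeriv.sq_sub_le {f u : ℝ → ℝ} (h : IsWeakDeriv f u) {a b : ℝ} (ha : 0 ≤ a)
    (hab : a ≤ b) (hb : b ≤ 1) : (f b - f a) ^ 2 ≤ (b - a) * ∫ t in a..b, u t ^ 2 := by
  have ha' : a ∈ Icc (0 : ℝ) 1 := ⟨ha, hab.trans hb⟩
  have hb' : b ∈ Icc (0 : ℝ) 1 := ⟨ha.trans hab, hb⟩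
  rw [h.sub_eq_integral ha' hb']
  exact sq_integral_le hab (h.integrableOn.intervalIntegrable_of_unit ha' hb')
    (h.integrableOn_sq.intervalIntegrable_of_unit ha' hb')

theorem integral_sq_mono {u : ℝ → ℝ} (hu : IntegrableOn (fun t => u t ^ 2) (Icc 0 1))
    {a b a' b' : ℝ} (ha : 0 ≤ a) (haa : a ≤ a') (hab : a' ≤ b') (hbb : b' ≤ b) (hb : b ≤ 1) :
    ∫ t in a'..b', u t ^ 2 ≤ ∫ t in a..b, u t ^ 2 :=
  intervalIntegral.integral_mono_interval haa hab hbb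
    (Eventually.of_forall fun t => sq_nonneg (u t))
    (hu.intervalIntegrable_of_unit ⟨ha, haa.trans (hab.trans (hbb.trans hb))⟩
      ⟨ha.trans (haa.trans (hab.trans hbb)), hb⟩)

theorem integral_indicator_Ioc {h : ℝ → ℝ} {a b x : ℝ} (ha : 0 ≤ a) (hx : 0 ≤ x) :
    ∫ t in (0 : ℝ)..x, (Ioc a b).indicator h t = ∫ t in Ioc a (min x b), h t := by
  rw [intervalIntegral.integral_of_le hx, setIntegral_indicator measurableSet_Ioc,
    Ioc_inter_Ioc, max_eq_right ha]

/-- The Hilbert space `L²([0,1])`. -/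
abbrev UnitL2 : Type := Lp ℝ 2 (volume.restrict (Icc (0 : ℝ) 1))

/-- The primitive of `u - ∫ u` on `[0,1]`, extended by zero. -/
def meanFreePrimitive (u : ℝ → ℝ) (x : ℝ) : ℝ :=
  if x ∈ Ioo (0 : ℝ) 1 then (∫ t in (0 : ℝ)..x, u t) - x * ∫ t in (0 : ℝ)..1, u t else 0

theorem meanFreePrimitive_of_mem {u : ℝ → ℝ} {x : ℝ} (hx : x ∈ Icc (0 : ℝ) 1) :
    meanFreePrimitive u x = (∫ t in (0 : ℝ)..x, u t) - x * ∫ t in (0 : ℝ)..1, u t := by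
  rw [meanFreePrimitive]
  split_ifs with h
  · rfl
  · have : x = 0 ∨ x = 1 := by
      by_contra! hne
      exact h ⟨lt_of_le_of_ne hx.1 hne.1.symm, lt_of_le_of_ne hx.2 hne.2⟩
    rcases this with rfl | rfl <;> simp

theorem isWeakDeriv_meanFreePrimitive {u : ℝ → ℝ}
    (hu : MemLp u 2 (volume.restrict (Icc (0 : ℝ) 1))) :
    IsWeakDeriv (meanFreePrimitive u) (fun t => u t - ∫ s in (0 : ℝ)..1, u s) := by
  refine ⟨hu.sub (memLp_const _), fun x hx => ?_⟩
  have hui : IntegrableOn u (Icc 0 1) := hu.integrable (by norm_num)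
  have h0 : (0 : ℝ) ∈ Icc (0 : ℝ) 1 := by simp
  rw [meanFreePrimitive_of_mem hx, meanFreePrimitive_of_mem h0,
    intervalIntegral.integral_sub (hui.intervalIntegrable_of_unit h0 hx) (by simp),
    intervalIntegral.integral_const]
  simp

theorem meanFreePrimitive_mem_H10 {u : ℝ → ℝ}
    (hu : MemLp u 2 (volume.restrict (Icc (0 : ℝ) 1))) : meanFreePrimitive u ∈ H10 :=
  ⟨fun _ hx => if_neg hx, _, isWeakDeriv_meanFreePrimitive hu⟩

/-- A function in `H_0^1` is recovered from its weak derivative. -/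
theorem meanFreePrimitive_eq {g v : ℝ → ℝ} (hg : ∀ x ∉ Ioo (0 : ℝ) 1, g x = 0)
    (hv : IsWeakDeriv g v) : meanFreePrimitive v = g := by
  have h0 : g 0 = 0 := hg 0 (by simp)
  have h1 : ∫ t in (0 : ℝ)..1, v t = 0 := by
    have := hv.2 1 (by simp)
    rw [hg 1 (by simp), h0] at this
    linarith
  ext x
  by_cases hx : x ∈ Ioo (0 : ℝ) 1
  · rw [meanFreePrimitive_of_mem (Ioo_subset_Icc_self hx), h1, hv.2 x (Ioo_subset_Icc_self hx), h0]
    ring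
  · rw [meanFreePrimitive, if_neg hx, hg x hx]

theorem integral_unit_congr_ae {u v : ℝ → ℝ}
    (h : u =ᵐ[volume.restrict (Icc (0 : ℝ) 1)] v) {x : ℝ} (hx : x ∈ Icc (0 : ℝ) 1) :
    ∫ t in (0 : ℝ)..x, u t = ∫ t in (0 : ℝ)..x, v t := by
  rw [intervalIntegral.integral_of_le hx.1, intervalIntegral.integral_of_le hx.1]
  exact integral_congr_ae (ae_restrict_of_ae_restrict_of_subset
    (Ioc_subset_Icc_self.trans (Icc_subset_Icc_right hx.2)) h)

theorem meanFreePrimitive_congr {u v : ℝ → ℝ}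
    (h : u =ᵐ[volume.restrict (Icc (0 : ℝ) 1)] v) : meanFreePrimitive u = meanFreePrimitive v := by
  ext x
  by_cases hx : x ∈ Ioo (0 : ℝ) 1
  · rw [meanFreePrimitive_of_mem (Ioo_subset_Icc_self hx),
      meanFreePrimitive_of_mem (Ioo_subset_Icc_self hx),
      integral_unit_congr_ae h (Ioo_subset_Icc_self hx), integral_unit_congr_ae h (by simp)]
  · rw [meanFreePrimitive, meanFreePrimitive, if_neg hx, if_neg hx]

theorem UnitL2.integrableOn (u : UnitL2) : IntegrableOn u (Icc 0 1) :=
  (Lp.memLp u).integrable (by norm_num)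

theorem UnitL2.inner_eq (u v : UnitL2) : inner ℝ u v = ∫ t in (0 : ℝ)..1, u t * v t := by
  rw [L2.inner_def, intervalIntegral.integral_of_le zero_le_one, ← integral_Icc_eq_integral_Ioc]
  simp [mul_comm]

theorem UnitL2.norm_sq_eq (u : UnitL2) : ‖u‖ ^ 2 = ∫ t in (0 : ℝ)..1, u t ^ 2 := by
  rw [← real_inner_self_eq_norm_sq, UnitL2.inner_eq]
  simp only [sq]

/-- The linear map sending the class of `u` to the primitive of `u - ∫ u`. -/
def primitiveₗ : UnitL2 →ₗ[ℝ] (ℝ → ℝ) where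
  toFun u := meanFreePrimitive u
  map_add' u v := by
    rw [meanFreePrimitive_congr (Lp.coeFn_add u v)]
    ext x
    simp only [Pi.add_apply]
    by_cases hx : x ∈ Ioo (0 : ℝ) 1
    · have hx' := Ioo_subset_Icc_self hx
      have h0 : (0 : ℝ) ∈ Icc (0 : ℝ) 1 := by simp
      have h1 : (1 : ℝ) ∈ Icc (0 : ℝ) 1 := by simp
      rw [meanFreePrimitive_of_mem hx', meanFreePrimitive_of_mem hx', meanFreePrimitive_of_mem hx']
      simp only [Pi.add_apply]
      rw [intervalIntegral.integral_add (u.integrableOn.intervalIntegrable_of_unit h0 hx')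
          (v.integrableOn.intervalIntegrable_of_unit h0 hx'),
        intervalIntegral.integral_add (u.integrableOn.intervalIntegrable_of_unit h0 h1)
          (v.integrableOn.intervalIntegrable_of_unit h0 h1)]
      ring
    · simp only [meanFreePrimitive, if_neg hx, add_zero]
  map_smul' c u := by
    rw [meanFreePrimitive_congr (Lp.coeFn_smul c u)]
    ext x
    simp only [Pi.smul_apply, RingHom.id_apply, smul_eq_mul]
    by_cases hx : x ∈ Ioo (0 : ℝ) 1
    · have hx' := Ioo_subset_Icc_self hx
      rw [meanFreePrimitive_of_mem hx', meanFreePrimitive_of_mem hx']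
      simp only [Pi.smul_apply, smul_eq_mul, intervalIntegral.integral_const_mul]
      ring
    · simp only [meanFreePrimitive, if_neg hx, mul_zero]

theorem primitiveₗ_apply (u : UnitL2) : primitiveₗ u = meanFreePrimitive u := rfl

theorem primitiveₗ_mem_H10 (u : UnitL2) : primitiveₗ u ∈ H10 :=
  meanFreePrimitive_mem_H10 (Lp.memLp u)

theorem integral_sub_mean_sq_le (u : UnitL2) :
    ∫ t in (0 : ℝ)..1, (u t - ∫ s in (0 : ℝ)..1, u s) ^ 2 ≤ ‖u‖ ^ 2 := by
  rw [UnitL2.norm_sq_eq]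
  set m := ∫ s in (0 : ℝ)..1, u s with hm
  have h0 : (0 : ℝ) ∈ Icc (0 : ℝ) 1 := by simp
  have h1 : (1 : ℝ) ∈ Icc (0 : ℝ) 1 := by simp
  have hu := u.integrableOn.intervalIntegrable_of_unit h0 h1
  have hu2 : IntervalIntegrable (fun t => u t ^ 2) volume 0 1 :=
    IntegrableOn.intervalIntegrable_of_unit (Lp.memLp u).integrable_sq h0 h1
  have : ∀ t, (u t - m) ^ 2 = u t ^ 2 - (2 * m) * u t + m ^ 2 := fun t => by ring
  simp only [this]
  rw [intervalIntegral.integral_add (hu2.sub (hu.const_mul _)) (by simp),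
    intervalIntegral.integral_sub hu2 (hu.const_mul _), intervalIntegral.integral_const_mul,
    intervalIntegral.integral_const, ← hm, smul_eq_mul]
  nlinarith [sq_nonneg m]

/-- Hölder continuity of the primitive. -/
theorem sq_primitiveₗ_sub_le (u : UnitL2) {a b : ℝ} (ha : 0 ≤ a) (hab : a ≤ b) (hb : b ≤ 1) :
    (primitiveₗ u b - primitiveₗ u a) ^ 2 ≤ (b - a) * ‖u‖ ^ 2 := by
  have hw := isWeakDeriv_meanFreePrimitive (Lp.memLp u)
  refine (hw.sq_sub_le ha hab hb).trans (mul_le_mul_of_nonneg_left ?_ (sub_nonneg.2 hab))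
  exact (integral_sq_mono hw.integrableOn_sq le_rfl ha hab hb le_rfl).trans
    (integral_sub_mean_sq_le u)

theorem primitiveₗ_of_notMem (u : UnitL2) {x : ℝ} (hx : x ∉ Ioo (0 : ℝ) 1) :
    primitiveₗ u x = 0 := if_neg hx

theorem abs_primitiveₗ_le (u : UnitL2) (x : ℝ) : |primitiveₗ u x| ≤ ‖u‖ := by
  by_cases hx : x ∈ Ioo (0 : ℝ) 1
  · refine abs_le_of_sq_le_sq ?_ (norm_nonneg u)
    have := sq_primitiveₗ_sub_le u le_rfl hx.1.le hx.2.le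
    rw [primitiveₗ_of_notMem u (x := 0) (by simp), sub_zero, sub_zero] at this
    nlinarith [hx.2, sq_nonneg ‖u‖]
  · rw [primitiveₗ_of_notMem u hx, abs_zero]
    exact norm_nonneg u

theorem aestronglyMeasurable_of_mem_H10 (ν : Measure ℝ) {f : ℝ → ℝ} (hf : f ∈ H10) :
    AEStronglyMeasurable f ν := by
  obtain ⟨hf0, u, hu⟩ := hf
  have : f = (Icc (0 : ℝ) 1).indicator f := by
    rw [eq_comm, indicator_eq_self]
    intro x hx
    by_contra hx'
    exact hx (hf0 x fun h => hx' (Ioo_subset_Icc_self h))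
  rw [this, aestronglyMeasurable_indicator_iff measurableSet_Icc]
  exact hu.continuousOn.aestronglyMeasurable measurableSet_Icc

variable (ν : Measure ℝ) [IsFiniteMeasure ν]

theorem memLp_primitiveₗ (u : UnitL2) : MemLp (primitiveₗ u) 2 ν :=
  MemLp.of_bound (aestronglyMeasurable_of_mem_H10 ν (primitiveₗ_mem_H10 u)) ‖u‖
    (Eventually.of_forall fun x => abs_primitiveₗ_le u x)

/-- The embedding `u ↦ ∫_0^· (u - ∫ u)` into `L²(ν)`. -/
def embed : UnitL2 →L[ℝ] Lp ℝ 2 ν :=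
  LinearMap.mkContinuous
    { toFun := fun u => (memLp_primitiveₗ ν u).toLp
      map_add' := fun u v => by
        rw [← MemLp.toLp_add]; congr 1; exact map_add primitiveₗ u v
      map_smul' := fun c u => by
        rw [RingHom.id_apply, ← MemLp.toLp_const_smul]; congr 1; exact map_smul primitiveₗ c u }
    (measureUnivNNReal ν ^ (2 : ℝ≥0∞).toReal⁻¹) fun u =>
      Lp.norm_le_of_ae_bound (norm_nonneg u) <| by
        filter_upwards [(memLp_primitiveₗ ν u).coeFn_toLp] with x hx
        exact (congrArg norm hx).trans_le (abs_primitiveₗ_le u x)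

theorem coeFn_embed (u : UnitL2) : embed ν u =ᵐ[ν] primitiveₗ u :=
  (memLp_primitiveₗ ν u).coeFn_toLp

theorem inner_embed (u v : UnitL2) :
    inner ℝ (embed ν u) (embed ν v) = innerNu ν (primitiveₗ u) (primitiveₗ v) := by
  rw [L2.inner_def, innerNu]
  refine integral_congr_ae ?_
  filter_upwards [coeFn_embed ν u, coeFn_embed ν v] with x hx hy
  simp [hx, hy, mul_comm]

/-- Evaluation of the primitive at a point. -/
def evalPrimitive (x : ℝ) : UnitL2 →L[ℝ] ℝ :=
  LinearMap.mkContinuous ((LinearMap.proj x : (ℝ → ℝ) →ₗ[ℝ] ℝ) ∘ₗ primitiveₗ) 1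
    fun u => by rw [one_mul]; exact abs_primitiveₗ_le u x

/-- The primitives are Hölder continuous with exponent `1/2`, so those vanishing at all points `k/n`
are bounded by `‖u‖/√n`. The embedding is therefore small on the common kernel of `n` point
evaluations. -/
theorem isCompactOperator_embed : IsCompactOperator (embed ν) := by
  refine isCompactOperator_of_forall_small_on_ker fun ε hε => ?_
  set M : ℝ := (measureUnivNNReal ν : ℝ) ^ (2 : ℝ≥0∞).toReal⁻¹ with hM
  have hM0 : 0 ≤ M := by positivity
  obtain ⟨n, hn⟩ := exists_nat_gt (max 0 ((M / ε) ^ 2))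
  have hn0 : (0 : ℝ) < n := (le_max_left _ _).trans_lt hn
  refine ⟨n, ContinuousLinearMap.pi fun k : Fin n => evalPrimitive ((k : ℝ) / n), fun u hu => ?_⟩
  have hzero : ∀ k < n, primitiveₗ u ((k : ℝ) / n) = 0 := fun k hk => congrFun hu ⟨k, hk⟩
  have hbound : ∀ x, |primitiveₗ u x| ≤ ‖u‖ / √n := by
    intro x
    by_cases hx : x ∈ Ioo (0 : ℝ) 1
    · have hk : ⌊x * n⌋₊ < n := by
        rw [Nat.floor_lt (by have := hx.1; positivity)]
        nlinarith [hx.2]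
      have h1 : ((⌊x * n⌋₊ : ℕ) : ℝ) / n ≤ x := by
        rw [div_le_iff₀ hn0]; exact Nat.floor_le (by have := hx.1; positivity)
      have h2 : x - ((⌊x * n⌋₊ : ℕ) : ℝ) / n ≤ 1 / n := by
        rw [sub_le_iff_le_add, ← add_div, le_div_iff₀ hn0, add_comm]
        exact (Nat.lt_floor_add_one _).le
      have h3 := sq_primitiveₗ_sub_le u (by positivity) h1 hx.2.le
      rw [hzero _ hk, sub_zero] at h3
      refine abs_le_of_sq_le_sq ?_ (by positivity)
      rw [div_pow, Real.sq_sqrt hn0.le]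
      refine h3.trans ((mul_le_mul_of_nonneg_right h2 (sq_nonneg _)).trans_eq ?_)
      ring
    · rw [primitiveₗ_of_notMem u hx, abs_zero]
      positivity
  have hnorm : ‖embed ν u‖ ≤ M * (‖u‖ / √n) :=
    Lp.norm_le_of_ae_bound (by positivity) <| by
      filter_upwards [coeFn_embed ν u] with x hx
      exact (congrArg norm hx).trans_le (hbound x)
  refine hnorm.trans ?_
  have hs : 0 < √(n : ℝ) := Real.sqrt_pos.2 hn0
  rw [← mul_div_assoc, div_le_iff₀ hs]
  have hMs : M / ε ≤ √n := Real.le_sqrt_of_sq_le ((le_max_right _ _).trans hn.le)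
  rw [div_le_iff₀ hε] at hMs
  nlinarith [norm_nonneg u]

end KreinFeller
end

/-! ### The Green operator and the variational lower bound. -/

noncomputable section

namespace KreinFeller

variable (ν : Measure ℝ) [IsFiniteMeasure ν]

/-- The compact symmetric operator on `L²([0,1])` whose nonzero eigenvalues are the inverses of
the eigenvalues of the form. -/
def greenOp : UnitL2 →L[ℝ] UnitL2 :=
  ContinuousLinearMap.adjoint (embed ν) ∘L embed ν

theorem inner_greenOp (u v : UnitL2) :
    inner ℝ (greenOp ν u) v = innerNu ν (primitiveₗ u) (primitiveₗ v) := by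
  rw [← inner_embed, greenOp, ContinuousLinearMap.comp_apply,
    ContinuousLinearMap.adjoint_inner_left]

theorem isSymmetric_greenOp : (greenOp ν : UnitL2 →ₗ[ℝ] UnitL2).IsSymmetric := fun u v => by
  rw [ContinuousLinearMap.coe_coe, inner_greenOp, real_inner_comm, inner_greenOp]
  simp only [innerNu, mul_comm]

theorem isCompactOperator_greenOp : IsCompactOperator (greenOp ν) := by
  rw [greenOp, ContinuousLinearMap.coe_comp]
  exact (isCompactOperator_embed ν).clm_comp _

/-- A solution of the eigenvalue equation is affine on intervals without mass. -/
theorem eq_affine_of_measure_Icc_eq_zero {ν : Measure ℝ} {f u : ℝ → ℝ} {lam : ℝ}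
    (hu : IsWeakDeriv f u)
    (heq : ∀ g ∈ H10, energy f g = lam * innerNu ν f g) {a b x : ℝ} (ha : 0 ≤ a) (hb : b ≤ 1)
    (hab : a < b) (hν : ν (Icc a b) = 0) (hx : x ∈ Icc a b) :
    f x = f a + (f b - f a) / (b - a) * (x - a) := by
  set s := (f b - f a) / (b - a) with hs
  have hba : 0 < b - a := sub_pos.2 hab
  have h0 : (0 : ℝ) ∈ Icc (0 : ℝ) 1 := by simp
  have h1 : (1 : ℝ) ∈ Icc (0 : ℝ) 1 := by simp
  have ha' : a ∈ Icc (0 : ℝ) 1 := ⟨ha, hab.le.trans hb⟩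
  have hb' : b ∈ Icc (0 : ℝ) 1 := ⟨ha.trans hab.le, hb⟩
  -- `w` is the derivative of the test function. It has mean zero on `(a,b]`, so its primitive lives
  -- on the null set `[a,b]` and the `ν`-term drops out. What remains is `∫ u (u - s) = ∫ (u - s)² =
  -- 0` over `[a,b]`.
  set w : ℝ → ℝ := (Ioc a b).indicator fun t => u t - s with hw
  have hus : MemLp (fun t => u t - s) 2 (volume.restrict (Icc (0 : ℝ) 1)) :=
    hu.1.sub (memLp_const s)
  have hw2 : MemLp w 2 (volume.restrict (Icc (0 : ℝ) 1)) := hus.indicator measurableSet_Ioc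
  have hfint : ∀ y ∈ Icc a b, ∫ t in a..y, (u t - s) = f y - f a - s * (y - a) := by
    intro y hy
    have hy' : y ∈ Icc (0 : ℝ) 1 := ⟨ha.trans hy.1, hy.2.trans hb⟩
    rw [intervalIntegral.integral_sub (hu.integrableOn.intervalIntegrable_of_unit ha' hy')
      (by simp), ← hu.sub_eq_integral ha' hy', intervalIntegral.integral_const, smul_eq_mul]
    ring
  have hwtot : ∫ t in a..b, (u t - s) = 0 := by
    rw [hfint b ⟨hab.le, le_rfl⟩, hs]; field_simp; ring
  have hw1 : ∫ t in (0 : ℝ)..1, w t = 0 := by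
    rw [hw, integral_indicator_Ioc ha zero_le_one, min_eq_right hb,
      ← intervalIntegral.integral_of_le hab.le, hwtot]
  have hzero : ∀ y ∉ Icc a b, meanFreePrimitive w y = 0 := by
    intro y hy
    by_cases hy1 : y ∈ Ioo (0 : ℝ) 1
    · rw [meanFreePrimitive_of_mem (Ioo_subset_Icc_self hy1), hw1, mul_zero, sub_zero, hw,
        integral_indicator_Ioc ha hy1.1.le]
      rcases lt_or_ge y a with h | h
      · rw [Ioc_eq_empty (by simp [h.le]), setIntegral_empty]
      · have : b < y := by by_contra! h'; exact hy ⟨h, h'⟩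
        rw [min_eq_right this.le, ← intervalIntegral.integral_of_le hab.le, hwtot]
    · rw [meanFreePrimitive, if_neg hy1]
  have hν' : innerNu ν f (meanFreePrimitive w) = 0 := by
    rw [innerNu]
    refine integral_eq_zero_of_ae ?_
    have : ∀ᵐ t ∂ν, t ∉ Icc a b := measure_eq_zero_iff_ae_notMem.1 hν
    filter_upwards [this] with t ht
    simp [hzero t ht]
  have hE := heq _ (meanFreePrimitive_mem_H10 hw2)
  rw [hν', mul_zero, energy_eq hu (isWeakDeriv_meanFreePrimitive hw2), hw1] at hE
  have hE' : ∫ t in a..b, u t * (u t - s) = 0 := by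
    rw [← hE]
    have : (fun t => u t * (w t - 0)) = (Ioc a b).indicator fun t => u t * (u t - s) := by
      ext t
      by_cases ht : t ∈ Ioc a b <;> simp [hw, ht]
    rw [this, integral_indicator_Ioc ha zero_le_one, min_eq_right hb,
      ← intervalIntegral.integral_of_le hab.le]
  have hsq2 : IntegrableOn (fun t => (u t - s) ^ 2) (Icc 0 1) := hus.integrable_sq
  have hsq : ∫ t in a..b, (u t - s) ^ 2 = 0 := by
    have h2 : (fun t => u t * (u t - s)) = fun t => (u t - s) ^ 2 + s * (u t - s) := by
      ext t; ring
    have h3 : IntervalIntegrable (fun t => u t - s) volume a b :=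
      IntegrableOn.intervalIntegrable_of_unit (hus.integrable (by norm_num)) ha' hb'
    rwa [h2, intervalIntegral.integral_add (hsq2.intervalIntegrable_of_unit ha' hb')
      (h3.const_mul s), intervalIntegral.integral_const_mul, hwtot, mul_zero, add_zero] at hE'
  have hx' : x ∈ Icc (0 : ℝ) 1 := ⟨ha.trans hx.1, hx.2.trans hb⟩
  have hCS := sq_integral_le hx.1 (IntegrableOn.intervalIntegrable_of_unit
    (hus.integrable (by norm_num)) ha' hx') (hsq2.intervalIntegrable_of_unit ha' hx')
  have hle := integral_sq_mono hsq2 ha le_rfl hx.1 hx.2 hb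
  rw [hsq] at hle
  rw [hfint x hx] at hCS
  have hfin : (f x - f a - s * (x - a)) ^ 2 ≤ 0 :=
    hCS.trans (mul_nonpos_of_nonneg_of_nonpos (sub_nonneg.2 hx.1) hle)
  have := pow_eq_zero_iff (two_ne_zero) |>.1 (le_antisymm hfin (sq_nonneg _))
  linarith

/-- A function satisfying the three point condition for affinity on a set is affine there. -/
theorem exists_affine_of_forall_three_points {f : ℝ → ℝ} {s : Set ℝ}
    (h : ∀ a ∈ s, ∀ b ∈ s, a < b → ∀ x ∈ Icc a b,
      f x = f a + (f b - f a) / (b - a) * (x - a)) {x₀ : ℝ} (hx₀ : x₀ ∈ s) :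
    ∃ c d : ℝ, ∀ y ∈ s, f y = c * y + d := by
  by_cases hne : ∃ y₀ ∈ s, x₀ ≠ y₀
  · obtain ⟨y₀, hy₀, hne⟩ := hne
    have key : ∀ a ∈ s, ∀ b ∈ s, a < b →
        ∀ y ∈ s, f y = f a + (f b - f a) / (b - a) * (y - a) := by
      intro a ha b hb hab y hy
      have hba : b - a ≠ 0 := (sub_pos.2 hab).ne'
      rcases lt_or_ge y a with hya | hya
      -- The hypothesis only covers middle points; for `y` outside `[a,b]` it is applied with `y` as
      -- an endpoint and solved for `f y`.
      · have := h y hy b hb (hya.trans hab) a ⟨hya.le, hab.le⟩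
        have h2 : b - y ≠ 0 := by linarith
        field_simp at this ⊢
        linarith
      · rcases le_or_gt y b with hyb | hyb
        · exact h a ha b hb hab y ⟨hya, hyb⟩
        · have := h a ha y hy (hab.trans hyb) b ⟨hab.le, hyb.le⟩
          have h2 : y - a ≠ 0 := by linarith
          field_simp at this ⊢
          linarith
    have aff : ∀ a ∈ s, ∀ b ∈ s, a < b → ∃ c d : ℝ, ∀ y ∈ s, f y = c * y + d := by
      intro a ha b hb hab
      exact ⟨(f b - f a) / (b - a), f a - (f b - f a) / (b - a) * a, fun y hy => by
        rw [key a ha b hb hab y hy]; ring⟩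
    rcases lt_or_gt_of_ne hne with hlt | hlt
    · exact aff x₀ hx₀ y₀ hy₀ hlt
    · exact aff y₀ hy₀ x₀ hx₀ hlt
  · push Not at hne
    exact ⟨0, f x₀, fun y hy => by rw [← hne y hy]; ring⟩

/-- A component of the complement of the support is order connected, so the interval between two of
its points is `ν`-null. Testing against all of `H10` thus puts eigenfunctions into the form domain
automatically, and no projection onto that domain is needed. -/
theorem mem_CNu_of_forall_energy_eq {ν : Measure ℝ} {f u : ℝ → ℝ} {lam : ℝ}
    (hu : IsWeakDeriv f u) (heq : ∀ g ∈ H10, energy f g = lam * innerNu ν f g) : f ∈ CNu ν := by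
  refine ⟨hu.continuousOn, fun x hx => ?_⟩
  set s := connectedComponentIn (Icc (0 : ℝ) 1 \ ν.support) x with hs
  have hsub : s ⊆ Icc (0 : ℝ) 1 \ ν.support := connectedComponentIn_subset _ _
  have hord : s.OrdConnected := isPreconnected_connectedComponentIn.ordConnected
  refine exists_affine_of_forall_three_points (fun a ha b hb hab y hy => ?_)
    (mem_connectedComponentIn hx)
  refine eq_affine_of_measure_Icc_eq_zero hu heq (hsub ha).1.1 (hsub hb).1.2 hab ?_ hy
  exact measure_mono_null (fun t ht => (hsub (hord.out ha hb ht)).2)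
    (Measure.measure_compl_support (μ := ν))

variable {ν}

/-- Constants are killed by `primitiveₗ`; pairing the eigenvalue equation with `1` gives `μ ∫ u =
0`. -/
theorem integral_eq_zero_of_mem_eigenspace_greenOp {μ : ℝ} (hμ : μ ≠ 0) {u : UnitL2}
    (hu : u ∈ Module.End.eigenspace (greenOp ν : UnitL2 →ₗ[ℝ] UnitL2) μ) :
    ∫ t in (0 : ℝ)..1, u t = 0 := by
  have hRu : greenOp ν u = μ • u := Module.End.mem_eigenspace_iff.1 hu
  have hone : MemLp (fun _ : ℝ => (1 : ℝ)) 2 (volume.restrict (Icc (0 : ℝ) 1)) := memLp_const 1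
  have h1 := inner_greenOp ν u hone.toLp
  have hp : primitiveₗ hone.toLp = 0 := by
    rw [primitiveₗ_apply, meanFreePrimitive_congr hone.coeFn_toLp]
    ext x
    by_cases hx : x ∈ Ioo (0 : ℝ) 1
    · rw [meanFreePrimitive_of_mem (Ioo_subset_Icc_self hx)]; simp
    · rw [meanFreePrimitive, if_neg hx]; rfl
  rw [hp, hRu, inner_smul_left, UnitL2.inner_eq] at h1
  have h2 : ∫ t in (0 : ℝ)..1, u t * (hone.toLp : UnitL2) t = ∫ t in (0 : ℝ)..1, u t := by
    refine integral_unit_congr_ae ?_ (by simp)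
    filter_upwards [hone.coeFn_toLp] with t ht
    rw [ht, mul_one]
  rw [h2] at h1
  simpa [innerNu, hμ] using h1

theorem isWeakDeriv_of_mem_eigenspace_greenOp {μ : ℝ} (hμ : μ ≠ 0) {u : UnitL2}
    (hu : u ∈ Module.End.eigenspace (greenOp ν : UnitL2 →ₗ[ℝ] UnitL2) μ) :
    IsWeakDeriv (primitiveₗ u) u := by
  have := isWeakDeriv_meanFreePrimitive (Lp.memLp u)
  simpa [integral_eq_zero_of_mem_eigenspace_greenOp hμ hu, primitiveₗ_apply] using this

theorem energy_primitiveₗ_of_mem_eigenspace {μ : ℝ} (hμ : μ ≠ 0) {u : UnitL2}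
    (hu : u ∈ Module.End.eigenspace (greenOp ν : UnitL2 →ₗ[ℝ] UnitL2) μ) {g : ℝ → ℝ}
    (hg : g ∈ H10) : energy (primitiveₗ u) g = μ⁻¹ * innerNu ν (primitiveₗ u) g := by
  obtain ⟨hg0, v, hv⟩ := hg
  have hRu : greenOp ν u = μ • u := Module.End.mem_eigenspace_iff.1 hu
  rw [energy_eq (isWeakDeriv_of_mem_eigenspace_greenOp hμ hu) hv]
  have h1 : primitiveₗ hv.1.toLp = g := by
    rw [primitiveₗ_apply, meanFreePrimitive_congr hv.1.coeFn_toLp, meanFreePrimitive_eq hg0 hv]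
  have h2 := inner_greenOp ν u hv.1.toLp
  rw [h1, hRu, inner_smul_left, UnitL2.inner_eq] at h2
  have h3 : ∫ t in (0 : ℝ)..1, u t * (hv.1.toLp : UnitL2) t = ∫ t in (0 : ℝ)..1, u t * v t := by
    refine integral_unit_congr_ae ?_ (by simp)
    filter_upwards [hv.1.coeFn_toLp] with t ht
    rw [ht]
  rw [h3] at h2
  rw [← h2]
  simp [hμ]

theorem primitiveₗ_mem_eigenspace {μ : ℝ} (hμ : μ ≠ 0) {u : UnitL2}
    (hu : u ∈ Module.End.eigenspace (greenOp ν : UnitL2 →ₗ[ℝ] UnitL2) μ) :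
    primitiveₗ u ∈ eigenspace ν μ⁻¹ := by
  have heq := fun g hg => energy_primitiveₗ_of_mem_eigenspace hμ hu (g := g) hg
  exact ⟨⟨primitiveₗ_mem_H10 u, mem_CNu_of_forall_energy_eq
    (isWeakDeriv_of_mem_eigenspace_greenOp hμ hu) heq⟩, fun g hg => heq g hg.1⟩

/-- `primitiveₗ` is injective on the eigenspace, since there `u` is the weak derivative of its own
primitive. Only this inequality is needed for the lower bound on the counting function. -/
theorem toENat_rank_eigenspace_le {μ : ℝ} (hμ : μ ≠ 0) :
    Cardinal.toENat (Module.rank ℝ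
      (Module.End.eigenspace (greenOp ν : UnitL2 →ₗ[ℝ] UnitL2) μ)) ≤ multiplicity ν μ⁻¹ := by
  rw [multiplicity]
  gcongr
  let Φ : Module.End.eigenspace (greenOp ν : UnitL2 →ₗ[ℝ] UnitL2) μ →ₗ[ℝ] eigenspace ν μ⁻¹ :=
    (primitiveₗ ∘ₗ Submodule.subtype _).codRestrict _
      fun u => primitiveₗ_mem_eigenspace hμ u.2
  refine Φ.rank_le_of_injective ?_
  rw [← LinearMap.ker_eq_bot, LinearMap.ker_eq_bot']
  rintro ⟨u, hu⟩ h
  have h0 : primitiveₗ u = 0 := congrArg Subtype.val h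
  have hw := isWeakDeriv_of_mem_eigenspace_greenOp hμ hu
  rw [h0] at hw
  ext1
  exact Lp.ext ((hw.ae_unique IsWeakDeriv.zero).trans (Lp.coeFn_zero _ _ _).symm)

/-- Variational lower bound for the eigenvalue counting function. -/
theorem natCast_le_countingFunction {x : ℝ} (hx : 0 < x) {m : ℕ}
    (φ : (Fin m → ℝ) →ₗ[ℝ] UnitL2)
    (hφ : ∀ c, c ≠ 0 → ‖φ c‖ ^ 2 < x * innerNu ν (primitiveₗ (φ c)) (primitiveₗ (φ c))) :
    (m : ℝ≥0∞) ≤ countingFunction ν x := by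
  refine (natCast_le_tsum_rank_eigenspace (isCompactOperator_greenOp ν) (isSymmetric_greenOp ν)
    (inv_pos.2 hx) φ fun c hc => ?_).trans ?_
  · rw [inner_greenOp, inv_mul_lt_iff₀ hx]
    exact hφ c hc
  · rw [countingFunction]
    let e : Ici x⁻¹ → Iic x := fun μ => ⟨(μ : ℝ)⁻¹, inv_le_of_inv_le₀ hx μ.2⟩
    have he : Function.Injective e := fun a b hab =>
      Subtype.ext (inv_injective (congrArg Subtype.val hab))
    refine le_trans (ENNReal.tsum_le_tsum fun μ => ?_)
      (ENNReal.tsum_comp_le_tsum_of_injective he fun lam => (multiplicity ν lam : ℝ≥0∞))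
    have hμ : (μ : ℝ) ≠ 0 := ((inv_pos.2 hx).trans_le μ.2).ne'
    exact ENat.toENNReal_le.2 (toENat_rank_eigenspace_le hμ)

end KreinFeller
end

/-! ### The variational upper bound and a Poincaré inequality. -/

noncomputable section

namespace KreinFeller

theorem energy_comm (f g : ℝ → ℝ) : energy f g = energy g f := by
  simp only [energy, mul_comm]

theorem innerNu_comm (ν : Measure ℝ) (f g : ℝ → ℝ) : innerNu ν f g = innerNu ν g f := by
  simp only [innerNu, mul_comm]

theorem innerNu_self_nonneg (ν : Measure ℝ) (f : ℝ → ℝ) : 0 ≤ innerNu ν f f :=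
  integral_nonneg fun t => mul_self_nonneg (f t)

theorem energy_self_nonneg (f : ℝ → ℝ) : 0 ≤ energy f f :=
  intervalIntegral.integral_nonneg zero_le_one fun _ _ => mul_self_nonneg _

theorem energy_self_eq {f u : ℝ → ℝ} (hu : IsWeakDeriv f u) :
    energy f f = ∫ t in (0 : ℝ)..1, u t ^ 2 := by
  rw [energy_eq hu hu]; simp only [sq]

theorem eq_zero_of_energy_self_eq_zero {f : ℝ → ℝ} (hf : f ∈ H10) (h : energy f f = 0) :
    f = 0 := by
  obtain ⟨hf0, u, hu⟩ := hf
  rw [energy_self_eq hu] at h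
  ext x
  by_cases hx : x ∈ Ioo (0 : ℝ) 1
  · have h1 := hu.sq_sub_le le_rfl hx.1.le hx.2.le
    have h2 := integral_sq_mono hu.integrableOn_sq le_rfl le_rfl hx.1.le hx.2.le le_rfl
    rw [h] at h2
    rw [hf0 0 (by simp), sub_zero, sub_zero] at h1
    have h3 : f x ^ 2 ≤ 0 := h1.trans (mul_nonpos_of_nonneg_of_nonpos hx.1.le h2)
    exact pow_eq_zero_iff (two_ne_zero) |>.1 (le_antisymm h3 (sq_nonneg _))
  · exact hf0 x hx

theorem energy_sum_left {ι : Type*} (s : Finset ι) {F : ι → ℝ → ℝ} {g : ℝ → ℝ}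
    (hF : ∀ i ∈ s, F i ∈ H10) (hg : g ∈ H10) :
    energy (∑ i ∈ s, F i) g = ∑ i ∈ s, energy (F i) g := by
  classical
  induction s using Finset.induction_on with
  | empty =>
    have := energy_smul_left 0 (zero_mem H10) hg
    simpa using this
  | insert i s hi ih =>
    rw [Finset.sum_insert hi, Finset.sum_insert hi, energy_add_left
      (hF i (Finset.mem_insert_self i s))
      (sum_mem fun j hj => hF j (Finset.mem_insert_of_mem hj)) hg,
      ih fun j hj => hF j (Finset.mem_insert_of_mem hj)]

theorem innerNu_sum_left (ν : Measure ℝ) [IsFiniteMeasure ν] {ι : Type*} (s : Finset ι)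
    {F : ι → ℝ → ℝ} {g : ℝ → ℝ} (hF : ∀ i ∈ s, F i ∈ H10) (hg : g ∈ H10) :
    innerNu ν (∑ i ∈ s, F i) g = ∑ i ∈ s, innerNu ν (F i) g := by
  simp only [innerNu, Finset.sum_apply, Finset.sum_mul]
  exact integral_finsetSum s fun i hi => integrable_mul ν (hF i hi) hg

variable {ν : Measure ℝ} [IsFiniteMeasure ν]

theorem innerNu_eq_zero_of_mem_eigenspace {a b : ℝ} (hab : a ≠ b) {f g : ℝ → ℝ}
    (hf : f ∈ eigenspace ν a) (hg : g ∈ eigenspace ν b) : innerNu ν f g = 0 := by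
  have h1 := hf.2 g hg.1
  have h2 := hg.2 f hf.1
  rw [energy_comm, innerNu_comm, h1] at h2
  have : (a - b) * innerNu ν f g = 0 := by linarith
  exact (mul_eq_zero.1 this).resolve_left (sub_ne_zero.2 hab)

/-- Variational upper bound for the eigenvalue counting function. -/
theorem countingFunction_le_card {x c : ℝ} (hx : 0 ≤ x) (hxc : x * c < 1) (P : Finset ℝ)
    (hP : ∀ f ∈ H10, (∀ p ∈ P, f p = 0) → innerNu ν f f ≤ c * energy f f) :
    countingFunction ν x ≤ P.card := by
  rw [countingFunction]
  refine ENNReal.summable.tsum_le_of_sum_le fun S => ?_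
  -- Sum one eigenfunction for each eigenvalue in `S` and evaluate at the points of `P`. Injectivity
  -- bounds the total multiplicity over `S` by the size of `P`.
  let Ψ : (∀ i : S, eigenspace ν ((i : Iic x) : ℝ)) →ₗ[ℝ] (P → ℝ) :=
    LinearMap.funLeft ℝ ℝ (fun p : P => (p : ℝ)) ∘ₗ
      ∑ i : S, Submodule.subtype _ ∘ₗ LinearMap.proj i
  have hΨ : Function.Injective Ψ := by
    rw [← LinearMap.ker_eq_bot, LinearMap.ker_eq_bot']
    intro F hF
    set f : ℝ → ℝ := ∑ i : S, (F i : ℝ → ℝ) with hf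
    have hF10 : ∀ i ∈ (Finset.univ : Finset S), (F i : ℝ → ℝ) ∈ H10 := fun i _ => (F i).2.1.1
    have hdom : f ∈ formDomain ν := sum_mem fun i _ => (F i).2.1
    have hfP : ∀ p ∈ P, f p = 0 := by
      intro p hp
      have := congrFun hF ⟨p, hp⟩
      simpa [Ψ, hf, LinearMap.funLeft_apply, LinearMap.sum_apply] using this
    have hcross : ∀ i : S, innerNu ν (F i) f = innerNu ν (F i) (F i) := by
      intro i
      rw [innerNu_comm, hf, innerNu_sum_left ν _ hF10 (F i).2.1.1]
      refine Finset.sum_eq_single_of_mem i (Finset.mem_univ i) fun j _ hj => ?_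
      exact innerNu_eq_zero_of_mem_eigenspace
        (fun h => hj (Subtype.ext (Subtype.ext h))) (F j).2 (F i).2
    have hI : innerNu ν f f = ∑ i : S, innerNu ν (F i) (F i) := by
      conv_lhs => rw [hf, ← hf, innerNu_sum_left ν _ hF10 hdom.1]
      exact Finset.sum_congr rfl fun i _ => hcross i
    have hE : energy f f = ∑ i : S, ((i : Iic x) : ℝ) * innerNu ν (F i) (F i) := by
      conv_lhs => rw [hf, ← hf, energy_sum_left _ hF10 hdom.1]
      exact Finset.sum_congr rfl fun i _ => by rw [(F i).2.2 f hdom, hcross]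
    have hEI : energy f f ≤ x * innerNu ν f f := by
      rw [hE, hI, Finset.mul_sum]
      exact Finset.sum_le_sum fun i _ =>
        mul_le_mul_of_nonneg_right i.1.2 (innerNu_self_nonneg ν _)
    have hb := hP f hdom.1 hfP
    -- Orthogonality gives energy at most `x` times the `ν`-norm squared, while `hP` bounds the
    -- latter by `c` times the energy; `x * c < 1` forces both to vanish.
    have hE0 : energy f f = 0 := by
      have h0 := energy_self_nonneg f
      have : energy f f ≤ x * (c * energy f f) := hEI.trans (mul_le_mul_of_nonneg_left hb hx)
      nlinarith
    have hI0 : innerNu ν f f = 0 := by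
      rw [hE0, mul_zero] at hb
      exact le_antisymm hb (innerNu_self_nonneg ν f)
    -- The `ν`-form need not be definite on `H10`. The eigenvalue equation transfers its vanishing
    -- to the energy of each component, and the energy is definite.
    rw [hI, Finset.sum_eq_zero_iff_of_nonneg fun i _ => innerNu_self_nonneg ν _] at hI0
    ext1 i
    refine Subtype.ext (eq_zero_of_energy_self_eq_zero (F i).2.1.1 ?_)
    rw [(F i).2.2 _ (F i).2.1, hI0 i (Finset.mem_univ i), mul_zero]
  have hfdpi : FiniteDimensional ℝ (∀ i : S, eigenspace ν ((i : Iic x) : ℝ)) :=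
    FiniteDimensional.of_injective Ψ hΨ
  have hfd : ∀ i : S, FiniteDimensional ℝ (eigenspace ν ((i : Iic x) : ℝ)) := fun i => by
    classical
    exact FiniteDimensional.of_injective
      (LinearMap.single ℝ (fun i : S => eigenspace ν ((i : Iic x) : ℝ)) i)
      (fun a b h => by simpa using congrFun h i)
  have hle := LinearMap.finrank_le_finrank_of_injective hΨ
  rw [Module.finrank_pi_fintype, Module.finrank_fintype_fun_eq_card, Fintype.card_coe] at hle
  rw [← Finset.sum_coe_sort]
  have hmult : ∀ i : S, ((multiplicity ν ((i : Iic x) : ℝ) : ℕ∞) : ℝ≥0∞) =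
      (Module.finrank ℝ (eigenspace ν ((i : Iic x) : ℝ)) : ℝ≥0∞) := fun i => by
    have := hfd i
    rw [multiplicity, ← Module.finrank_eq_rank, Cardinal.toENat_nat]; rfl
  rw [Finset.sum_congr rfl fun i _ => hmult i]
  exact_mod_cast hle

/-- A Poincaré inequality for functions vanishing at the left endpoints of a partition. -/
theorem innerNu_self_le_of_partition {ι : Type*} (Q : Finset ι) {a b : ι → ℝ} {c : ℝ}
    (ha : ∀ i ∈ Q, 0 ≤ a i) (hab : ∀ i ∈ Q, a i ≤ b i) (hb : ∀ i ∈ Q, b i ≤ 1)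
    (hdisj : (Q : Set ι).Pairwise (Function.onFun Disjoint fun i => Ioc (a i) (b i)))
    (hcover : ∀ x ∈ Ioo (0 : ℝ) 1, ∃ i ∈ Q, x ∈ Ioc (a i) (b i))
    (hc0 : 0 ≤ c) (hc : ∀ i ∈ Q, ν.real (Ioc (a i) (b i)) * (b i - a i) ≤ c)
    {f : ℝ → ℝ} (hf : f ∈ H10) (hfa : ∀ i ∈ Q, f (a i) = 0) :
    innerNu ν f f ≤ c * energy f f := by
  have hfint := integrable_mul ν hf hf
  obtain ⟨hf0, u, hu⟩ := hf
  have hu2 : IntegrableOn (fun t => u t ^ 2) (⋃ i ∈ Q, Ioc (a i) (b i)) :=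
    hu.integrableOn_sq.mono_set (iUnion₂_subset fun i hi t ht =>
      ⟨(ha i hi).trans ht.1.le, ht.2.trans (hb i hi)⟩)
  calc innerNu ν f f = ∫ t in Ioo (0 : ℝ) 1, f t * f t ∂ν := by
        rw [innerNu, setIntegral_eq_integral_of_forall_compl_eq_zero]
        intro x hx
        rw [hf0 x hx, mul_zero]
    _ ≤ ∫ t in ⋃ i ∈ Q, Ioc (a i) (b i), f t * f t ∂ν := by
        refine setIntegral_mono_set hfint.integrableOn
          (Eventually.of_forall fun t => mul_self_nonneg (f t)) ?_
        refine LE.le.eventuallyLE fun x hx => ?_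
        obtain ⟨i, hi, hxi⟩ := hcover x hx
        exact mem_iUnion₂.2 ⟨i, hi, hxi⟩
    _ = ∑ i ∈ Q, ∫ t in Ioc (a i) (b i), f t * f t ∂ν :=
        integral_biUnion_finset Q (fun i _ => measurableSet_Ioc) hdisj
          fun i _ => hfint.integrableOn
    _ ≤ ∑ i ∈ Q, c * ∫ t in Ioc (a i) (b i), u t ^ 2 := by
        refine Finset.sum_le_sum fun i hi => ?_
        set E := ∫ t in Ioc (a i) (b i), u t ^ 2 with hE
        have hE0 : 0 ≤ E := integral_nonneg fun t => sq_nonneg _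
        have hpt : ∀ t ∈ Ioc (a i) (b i), f t * f t ≤ (b i - a i) * E := by
          intro t ht
          have h1 := hu.sq_sub_le (ha i hi) ht.1.le (ht.2.trans (hb i hi))
          have h2 := integral_sq_mono hu.integrableOn_sq (ha i hi) le_rfl ht.1.le ht.2 (hb i hi)
          rw [intervalIntegral.integral_of_le (hab i hi), ← hE] at h2
          rw [hfa i hi, sub_zero] at h1
          have h3 : 0 ≤ t - a i := sub_nonneg.2 ht.1.le
          have h4 : t - a i ≤ b i - a i := sub_le_sub_right ht.2 _
          calc f t * f t = f t ^ 2 := (sq _).symm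
            _ ≤ (t - a i) * E := h1.trans (mul_le_mul_of_nonneg_left h2 h3)
            _ ≤ _ := mul_le_mul_of_nonneg_right h4 hE0
        calc ∫ t in Ioc (a i) (b i), f t * f t ∂ν
            ≤ ∫ t in Ioc (a i) (b i), (b i - a i) * E ∂ν :=
              setIntegral_mono_on hfint.integrableOn (integrable_const _).integrableOn
                measurableSet_Ioc hpt
          _ = (ν.real (Ioc (a i) (b i)) * (b i - a i)) * E := by
              rw [setIntegral_const, smul_eq_mul]; ring
          _ ≤ c * E := mul_le_mul_of_nonneg_right (hc i hi) hE0
    _ = c * ∫ t in ⋃ i ∈ Q, Ioc (a i) (b i), u t ^ 2 := by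
        rw [integral_biUnion_finset Q (fun i _ => measurableSet_Ioc) hdisj
          fun i hi => hu2.mono_set (subset_biUnion_of_mem (u := fun i => Ioc (a i) (b i)) hi),
          Finset.mul_sum]
    _ ≤ c * energy f f := by
        rw [energy_self_eq hu, intervalIntegral.integral_of_le zero_le_one,
          ← integral_Icc_eq_integral_Ioc]
        refine mul_le_mul_of_nonneg_left ?_ hc0
        refine setIntegral_mono_set hu.integrableOn_sq
          (Eventually.of_forall fun t => sq_nonneg (u t)) ?_
        exact LE.le.eventuallyLE (iUnion₂_subset fun i hi t ht =>
          ⟨(ha i hi).trans ht.1.le, ht.2.trans (hb i hi)⟩)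

end KreinFeller
end

/-! ### Dyadic stopping intervals and the bound on the upper spectral dimension. -/

noncomputable section

namespace KreinFeller

theorem measurableSet_dyadic (n k : ℕ) : MeasurableSet (dyadic n k) := measurableSet_Ioc

theorem mem_dyadic_iff {n k : ℕ} {x : ℝ} :
    x ∈ dyadic n k ↔ (k : ℝ) < x * 2 ^ n ∧ x * 2 ^ n ≤ k + 1 := by
  rw [dyadic, mem_Ioc, div_lt_iff₀ (by positivity), le_div_iff₀ (by positivity)]

theorem eq_of_mem_dyadic {n k k' : ℕ} {x : ℝ} (h : x ∈ dyadic n k) (h' : x ∈ dyadic n k') :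
    k = k' := by
  rw [mem_dyadic_iff] at h h'
  have h1 : (k : ℝ) < k' + 1 := h.1.trans_le h'.2
  have h2 : (k' : ℝ) < k + 1 := h'.1.trans_le h.2
  norm_cast at h1 h2
  omega

theorem exists_mem_dyadic (n : ℕ) {x : ℝ} (hx : x ∈ Ioc (0 : ℝ) 1) :
    ∃ k < 2 ^ n, x ∈ dyadic n k := by
  have hpos : 0 < ⌈x * 2 ^ n⌉₊ := Nat.ceil_pos.2 (mul_pos hx.1 (by positivity))
  have hle : ⌈x * 2 ^ n⌉₊ ≤ 2 ^ n := by
    rw [Nat.ceil_le]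
    push_cast
    nlinarith [hx.2, pow_pos (two_pos : (0 : ℝ) < 2) n]
  refine ⟨⌈x * 2 ^ n⌉₊ - 1, by omega, ?_⟩
  rw [mem_dyadic_iff, Nat.cast_sub hpos]
  constructor
  · have := Nat.ceil_lt_add_one (mul_pos hx.1 (by positivity : (0 : ℝ) < 2 ^ n)).le
    push_cast
    linarith
  · have := Nat.le_ceil (x * 2 ^ n)
    push_cast
    linarith

theorem mem_dyadic_ancestor {m n k : ℕ} {x : ℝ} (hx : x ∈ dyadic n k) (hmn : m ≤ n) :
    x ∈ dyadic m (k / 2 ^ (n - m)) := by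
  rw [mem_dyadic_iff] at hx ⊢
  obtain ⟨d, rfl⟩ := Nat.exists_eq_add_of_le hmn
  rw [Nat.add_sub_cancel_left]
  have h1 : (k / 2 ^ d) * 2 ^ d ≤ k := Nat.div_mul_le_self _ _
  have h2 : k + 1 ≤ (k / 2 ^ d + 1) * 2 ^ d := by
    have := Nat.lt_mul_div_succ k (pow_pos two_pos d : 0 < 2 ^ d)
    rw [mul_comm]; exact this
  have h1' : ((k / 2 ^ d : ℕ) : ℝ) * 2 ^ d ≤ k := by exact_mod_cast h1
  have h2' : (k : ℝ) + 1 ≤ (((k / 2 ^ d : ℕ) : ℝ) + 1) * 2 ^ d := by exact_mod_cast h2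
  have hd : (0 : ℝ) < 2 ^ d := by positivity
  rw [pow_add, ← mul_assoc] at hx
  exact ⟨lt_of_mul_lt_mul_right (h1'.trans_lt hx.1) hd.le,
    le_of_mul_le_mul_right (hx.2.trans h2') hd⟩

variable (ν : Measure ℝ)

/-- The dyadic intervals of level at most `N` with small mass times length all of whose ancestors
have large mass times length. -/
def stoppingIntervals (t : ℝ) (N : ℕ) : Set (ℕ × ℕ) :=
  {p | p.1 ≤ N ∧ p.2 < 2 ^ p.1 ∧ ν.real (dyadic p.1 p.2) / 2 ^ p.1 < t ∧
    ∀ m < p.1, t ≤ ν.real (dyadic m (p.2 / 2 ^ (p.1 - m))) / 2 ^ m}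

/-- The dyadic intervals of level less than `N` with large mass times length. -/
def heavyIntervals (t : ℝ) (N : ℕ) : Set (ℕ × ℕ) :=
  {p | p.1 < N ∧ p.2 < 2 ^ p.1 ∧ t ≤ ν.real (dyadic p.1 p.2) / 2 ^ p.1}

theorem finite_stoppingIntervals (t : ℝ) (N : ℕ) : (stoppingIntervals ν t N).Finite := by
  refine ((Finset.range (N + 1)) ×ˢ (Finset.range (2 ^ N))).finite_toSet.subset ?_
  rintro ⟨n, k⟩ ⟨h1, h2, -⟩
  simp only [Finset.coe_product, Finset.coe_range, mem_prod, mem_Iio]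
  exact ⟨Nat.lt_succ_of_le h1, h2.trans_le (Nat.pow_le_pow_right two_pos h1)⟩

theorem finite_heavyIntervals (t : ℝ) (N : ℕ) : (heavyIntervals ν t N).Finite := by
  refine ((Finset.range N) ×ˢ (Finset.range (2 ^ N))).finite_toSet.subset ?_
  rintro ⟨n, k⟩ ⟨h1, h2, -⟩
  simp only [Finset.coe_product, Finset.coe_range, mem_prod, mem_Iio]
  exact ⟨h1, h2.trans_le (Nat.pow_le_pow_right two_pos h1.le)⟩

/-- Apart from the root, the parent of a stopping interval is heavy, and every parent has two
children. -/
theorem ncard_stoppingIntervals_le (t : ℝ) (N : ℕ) :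
    (stoppingIntervals ν t N).ncard ≤ 1 + 2 * (heavyIntervals ν t N).ncard := by
  set H := heavyIntervals ν t N with hH
  have hHf : H.Finite := finite_heavyIntervals ν t N
  let e : Bool → ℕ × ℕ → ℕ × ℕ := fun b p => (p.1 + 1, 2 * p.2 + b.toNat)
  have hsub : stoppingIntervals ν t N ⊆ {(0, 0)} ∪ (e false '' H ∪ e true '' H) := by
    rintro ⟨n, k⟩ ⟨h1, h2, h3, h4⟩
    rcases n with _ | n
    · left
      have : k = 0 := by simpa using h2
      simp [this]
    · right
      have hmem : (n, k / 2) ∈ H := by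
        have := h4 n (Nat.lt_succ_self n)
        simp only [Nat.add_sub_cancel_left, pow_one] at this
        refine ⟨h1, ?_, this⟩
        have h2' : k < 2 ^ (n + 1) := h2
        rw [pow_succ] at h2'
        change k / 2 < 2 ^ n
        omega
      rcases Nat.mod_two_eq_zero_or_one k with hk | hk
      · left
        refine ⟨_, hmem, ?_⟩
        simp only [e, Bool.toNat_false, Prod.mk.injEq, true_and]
        omega
      · right
        refine ⟨_, hmem, ?_⟩
        simp only [e, Bool.toNat_true, Prod.mk.injEq, true_and]
        omega
  refine (ncard_le_ncard hsub ((finite_singleton _).union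
    ((hHf.image _).union (hHf.image _)))).trans ?_
  refine (ncard_union_le _ _).trans ?_
  rw [ncard_singleton]
  have h1 := ncard_union_le (e false '' H) (e true '' H)
  have h2 := ncard_image_le (f := e false) hHf
  have h3 := ncard_image_le (f := e true) hHf
  omega

/-- The sum defining the `L^q`-spectrum, as a real number. -/
def lqSum (n : ℕ) (q : ℝ) : ℝ :=
  ∑ k ∈ Finset.range (2 ^ n) with 0 < ν (dyadic n k), ν.real (dyadic n k) ^ q

theorem lqSum_nonneg (n : ℕ) (q : ℝ) : 0 ≤ lqSum ν n q :=
  Finset.sum_nonneg fun _ _ => Real.rpow_nonneg measureReal_nonneg _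

/-- Markov's inequality: each heavy interval contributes `(ν(C) 2⁻ⁿ / t)^q ≥ 1` to the right-hand
side. -/
theorem natCast_ncard_heavyIntervals_le {t q : ℝ} (ht : 0 < t) (hq : 0 < q) (N : ℕ) :
    ((heavyIntervals ν t N).ncard : ℝ) ≤
      t ^ (-q) * ∑ n ∈ Finset.range N, (2 : ℝ) ^ (-(n * q)) * lqSum ν n q := by
  classical
  set T : Finset (Σ _ : ℕ, ℕ) := (Finset.range N).sigma fun n =>
    (Finset.range (2 ^ n)).filter fun k => 0 < ν (dyadic n k) with hT
  let w : (Σ _ : ℕ, ℕ) → ℝ := fun p => t ^ (-q) * ((2 : ℝ) ^ (-(p.1 * q)) *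
    ν.real (dyadic p.1 p.2) ^ q)
  have hw0 : ∀ p, 0 ≤ w p := fun p => by positivity
  have hsum : t ^ (-q) * ∑ n ∈ Finset.range N, (2 : ℝ) ^ (-(n * q)) * lqSum ν n q =
      ∑ p ∈ T, w p := by
    rw [hT, Finset.sum_sigma, Finset.mul_sum]
    refine Finset.sum_congr rfl fun n _ => ?_
    rw [lqSum, Finset.mul_sum, Finset.mul_sum]
  rw [hsum]
  set T' := T.filter fun p => t ≤ ν.real (dyadic p.1 p.2) / 2 ^ p.1 with hT'
  have hcard : (heavyIntervals ν t N).ncard ≤ T'.card := by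
    have himg : heavyIntervals ν t N ⊆
        (T'.image fun p : (Σ _ : ℕ, ℕ) => (p.1, p.2) : Finset (ℕ × ℕ)) := by
      rintro ⟨n, k⟩ ⟨h1, h2, h3⟩
      rw [Finset.coe_image]
      refine ⟨⟨n, k⟩, ?_, rfl⟩
      rw [Finset.mem_coe, hT', Finset.mem_filter, hT, Finset.mem_sigma, Finset.mem_filter]
      refine ⟨⟨Finset.mem_range.2 h1, Finset.mem_range.2 h2, ?_⟩, h3⟩
      have : 0 < ν.real (dyadic n k) := by
        by_contra! h
        have h4 : ν.real (dyadic n k) / 2 ^ n ≤ 0 :=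
          div_nonpos_of_nonpos_of_nonneg h (by positivity)
        exact absurd (ht.trans_le h3) h4.not_gt
      exact (ENNReal.toReal_pos_iff.1 this).1
    exact (ncard_le_ncard himg (Finset.finite_toSet _)).trans
      (by rw [ncard_coe_finset]; exact Finset.card_image_le)
  calc ((heavyIntervals ν t N).ncard : ℝ) ≤ T'.card := by exact_mod_cast hcard
    _ = ∑ p ∈ T', (1 : ℝ) := by simp
    _ ≤ ∑ p ∈ T', w p := by
        refine Finset.sum_le_sum fun p hp => ?_
        have hp' := (Finset.mem_filter.1 hp).2
        have h1 : (t : ℝ) ^ q ≤ (ν.real (dyadic p.1 p.2) / 2 ^ p.1) ^ q :=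
          Real.rpow_le_rpow ht.le hp' hq.le
        have h2 : (2 : ℝ) ^ (-(p.1 * q)) = ((2 : ℝ) ^ p.1 : ℝ)⁻¹ ^ q := by
          rw [Real.inv_rpow (by positivity), ← Real.rpow_natCast 2, ← Real.rpow_mul (by norm_num),
            Real.rpow_neg (by norm_num)]
        simp only [w]
        rw [h2, ← Real.mul_rpow (by positivity) measureReal_nonneg, Real.rpow_neg ht.le,
          inv_mul_eq_div, one_le_div (Real.rpow_pos_of_pos ht q), inv_mul_eq_div]
        exact h1
    _ ≤ ∑ p ∈ T, w p :=
        Finset.sum_le_sum_of_subset_of_nonneg (Finset.filter_subset _ _) fun p _ _ => hw0 p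

variable [IsFiniteMeasure ν]

/-- Eigenvalues are counted by stopping intervals. -/
theorem countingFunction_le_ncard_stoppingIntervals {x t : ℝ} (hx : 0 ≤ x) (ht : 0 < t)
    (hxt : x * t < 1) {N : ℕ} (hN : ν.real univ / 2 ^ N < t) :
    countingFunction ν x ≤ (stoppingIntervals ν t N).ncard := by
  classical
  set Q := (finite_stoppingIntervals ν t N).toFinset with hQ
  have hQmem : ∀ p, p ∈ Q ↔ p ∈ stoppingIntervals ν t N := fun p => by rw [hQ, Finite.mem_toFinset]
  let a : ℕ × ℕ → ℝ := fun p => (p.2 : ℝ) / 2 ^ p.1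
  let b : ℕ × ℕ → ℝ := fun p => ((p.2 : ℝ) + 1) / 2 ^ p.1
  refine (countingFunction_le_card hx hxt (Q.image a) fun f hf hfP => ?_).trans ?_
  · refine innerNu_self_le_of_partition Q (a := a) (b := b) (fun p _ => by positivity)
      (fun p _ => by simp only [a, b]; gcongr; linarith) (fun p hp => ?_) ?_ ?_ ht.le
      (fun p hp => ?_) hf fun p hp => hfP _ (Finset.mem_image_of_mem a hp)
    · rw [hQmem] at hp
      have h2 : (p.2 : ℝ) + 1 ≤ 2 ^ p.1 := by exact_mod_cast hp.2.1
      exact div_le_one_of_le₀ h2 (by positivity)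
    · intro p hp p' hp' hne
      rw [Function.onFun, Set.disjoint_left]
      intro y hy hy'
      have hy1 : y ∈ dyadic p.1 p.2 := hy
      have hy2 : y ∈ dyadic p'.1 p'.2 := hy'
      have hp := (hQmem p).1 hp
      have hp' := (hQmem p').1 hp'
      -- Dyadic intervals that meet are nested, and the larger would be a heavy ancestor of the
      -- smaller, contradicting its own stopping condition.
      rcases lt_trichotomy p.1 p'.1 with h | h | h
      · have h1 := eq_of_mem_dyadic hy1 (mem_dyadic_ancestor hy2 h.le)
        have h2 := hp'.2.2.2 _ h
        rw [← h1] at h2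
        exact absurd hp.2.2.1 h2.not_gt
      · exact hne (Prod.ext h (eq_of_mem_dyadic hy1 (by rw [h]; exact hy2)))
      · have h1 := eq_of_mem_dyadic hy2 (mem_dyadic_ancestor hy1 h.le)
        have h2 := hp.2.2.2 _ h
        rw [← h1] at h2
        exact absurd hp'.2.2.1 h2.not_gt
    · intro y hy
      have hy' : y ∈ Ioc (0 : ℝ) 1 := Ioo_subset_Ioc_self hy
      -- Stop at the first level whose interval around `y` is light; level `N` is always light by
      -- `hN`.
      let good : ℕ → Prop := fun n => ∃ k < 2 ^ n, y ∈ dyadic n k ∧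
        ν.real (dyadic n k) / 2 ^ n < t
      have hgood : good N := by
        obtain ⟨k, hk, hyk⟩ := exists_mem_dyadic N hy'
        refine ⟨k, hk, hyk, lt_of_le_of_lt ?_ hN⟩
        exact div_le_div_of_nonneg_right (measureReal_mono (subset_univ _)) (by positivity)
      have hex : ∃ n, good n := ⟨N, hgood⟩
      obtain ⟨k, hk, hyk, hlt⟩ := Nat.find_spec hex
      refine ⟨(Nat.find hex, k), (hQmem _).2 ⟨Nat.find_min' hex hgood, hk, hlt, fun m hm => ?_⟩,
        hyk⟩
      have hnot := Nat.find_min hex hm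
      by_contra! hcon
      refine hnot ⟨_, ?_, mem_dyadic_ancestor hyk hm.le, hcon⟩
      refine Nat.div_lt_of_lt_mul (hk.trans_eq ?_)
      rw [← pow_add]
      congr 1
      have : m < Nat.find hex := hm
      omega
    · have h3 := ((hQmem p).1 hp).2.2.1
      have h4 : b p - a p = 1 / 2 ^ p.1 := by simp only [a, b]; ring
      rw [h4, mul_one_div]
      exact h3.le
  · rw [ncard_eq_toFinset_card _ (finite_stoppingIntervals ν t N)]
    exact_mod_cast Finset.card_image_le

theorem upperSpectralDim_le_of_eventually_le {s K : ℝ}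
    (h : ∀ᶠ x in atTop, countingFunction ν x ≤ ENNReal.ofReal (K * x ^ s)) :
    upperSpectralDim ν ≤ (s : EReal) := by
  refine EReal.le_of_forall_lt_iff_le.1 fun z hz => ?_
  have hz' : s < z := EReal.coe_lt_coe_iff.1 hz
  set K' := max K 1 with hK'
  have hK0 : 0 < K' := zero_lt_one.trans_le (le_max_right _ _)
  refine limsup_le_of_le (by isBoundedDefault) ?_
  -- From here on `(z - s) log x` absorbs the constant `log K'`.
  have hlog := Real.tendsto_log_atTop.eventually_ge_atTop (Real.log K' / (z - s))
  filter_upwards [h, hlog, eventually_gt_atTop 1] with x hx hxK hx1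
  have hx0 : 0 < x := one_pos.trans hx1
  have hl : 0 < Real.log x := Real.log_pos hx1
  rw [EReal.div_le_iff_le_mul (by exact_mod_cast hl) (EReal.coe_ne_top _)]
  have hxs : 0 < x ^ s := Real.rpow_pos_of_pos hx0 s
  have h1 : countingFunction ν x ≤ ENNReal.ofReal (K' * x ^ s) :=
    hx.trans (ENNReal.ofReal_le_ofReal
      (mul_le_mul_of_nonneg_right (le_max_left _ _) hxs.le))
  refine (ENNReal.log_le_log h1).trans ?_
  rw [ENNReal.log_ofReal_of_pos (by positivity), Real.log_mul hK0.ne' hxs.ne',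
    Real.log_rpow hx0]
  rw [div_le_iff₀ (sub_pos.2 hz')] at hxK
  have : Real.log K' + s * Real.log x ≤ Real.log x * z := by nlinarith
  exact_mod_cast this

theorem le_lowerSpectralDim_of_eventually_le {s : ℝ}
    (h : ∀ᶠ x : ℝ in atTop, ENNReal.ofReal (x ^ s) ≤ countingFunction ν x) :
    (s : EReal) ≤ lowerSpectralDim ν := by
  refine le_liminf_of_le (by isBoundedDefault) ?_
  filter_upwards [h, eventually_gt_atTop 1] with x hx hx1
  have hx0 : 0 < x := one_pos.trans hx1
  have hl : 0 < Real.log x := Real.log_pos hx1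
  rw [EReal.le_div_iff_mul_le (by exact_mod_cast hl) (EReal.coe_ne_top _)]
  refine le_trans ?_ (ENNReal.log_le_log hx)
  rw [ENNReal.log_ofReal_of_pos (Real.rpow_pos_of_pos hx0 s), Real.log_rpow hx0]
  norm_cast

/-- Growth of the `L^q`-sums at a rate less than `q` bounds the upper spectral dimension. -/
theorem upperSpectralDim_le_of_lqSum_le {q r C : ℝ} (hq : 0 < q) (hr : r < q)
    (h : ∀ n, lqSum ν n q ≤ C * 2 ^ (n * r)) : upperSpectralDim ν ≤ (q : EReal) := by
  have hC : 0 ≤ C := by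
    have := (lqSum_nonneg ν 0 q).trans (h 0)
    simpa using this
  -- Since `r < q`, the weighted sums over levels form a convergent geometric series, so the bound
  -- `G` does not depend on the cutoff `N`.
  set ρ : ℝ := 2 ^ (r - q) with hρ
  have hρ0 : 0 ≤ ρ := by positivity
  have hρ1 : ρ < 1 := Real.rpow_lt_one_of_one_lt_of_neg one_lt_two (sub_neg.2 hr)
  set G : ℝ := C * (1 - ρ)⁻¹ with hG
  have hG0 : 0 ≤ G := mul_nonneg hC (inv_nonneg.2 (sub_nonneg.2 hρ1.le))
  have hsum : ∀ N : ℕ, ∑ n ∈ Finset.range N, (2 : ℝ) ^ (-(n * q)) * lqSum ν n q ≤ G := by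
    intro N
    calc ∑ n ∈ Finset.range N, (2 : ℝ) ^ (-(n * q)) * lqSum ν n q
        ≤ ∑ n ∈ Finset.range N, C * ρ ^ n := by
          refine Finset.sum_le_sum fun n _ => ?_
          refine (mul_le_mul_of_nonneg_left (h n) (by positivity)).trans_eq ?_
          rw [hρ, ← Real.rpow_natCast, ← Real.rpow_mul (by norm_num), mul_left_comm,
            ← Real.rpow_add two_pos]
          congr 2
          ring
      _ ≤ G := by
          rw [← Finset.mul_sum, hG]
          refine mul_le_mul_of_nonneg_left ?_ hC
          have hs := summable_geometric_of_lt_one hρ0 hρ1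
          rw [← tsum_geometric_of_lt_one hρ0 hρ1]
          exact hs.sum_le_tsum _ fun i _ => pow_nonneg hρ0 i
  refine upperSpectralDim_le_of_eventually_le ν (K := 1 + 2 * (2 ^ q * G)) ?_
  filter_upwards [eventually_ge_atTop 1] with x hx1
  have hx0 : 0 < x := one_pos.trans_le hx1
  -- This gives `x * t = 1/2 < 1`, and `t^(-q) = 2^q x^q` explains the constant `K` above.
  set t : ℝ := (2 * x)⁻¹ with ht
  have ht0 : 0 < t := by positivity
  have hxt : x * t < 1 := by rw [ht]; field_simp; norm_num
  obtain ⟨N, hN⟩ : ∃ N : ℕ, ν.real univ / 2 ^ N < t := by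
    obtain ⟨N, hN⟩ := pow_unbounded_of_one_lt (ν.real univ / t) (one_lt_two)
    refine ⟨N, ?_⟩
    rw [div_lt_iff₀ ht0] at hN
    rw [div_lt_iff₀ (by positivity)]
    linarith
  refine (countingFunction_le_ncard_stoppingIntervals ν hx0.le ht0 hxt hN).trans ?_
  rw [← ENNReal.ofReal_natCast]
  refine ENNReal.ofReal_le_ofReal ?_
  have h1 : ((stoppingIntervals ν t N).ncard : ℝ) ≤ 1 + 2 * ((heavyIntervals ν t N).ncard : ℝ) := by
    exact_mod_cast ncard_stoppingIntervals_le ν t N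
  have h2 := natCast_ncard_heavyIntervals_le ν ht0 hq N
  have h3 : t ^ (-q) = 2 ^ q * x ^ q := by
    rw [ht, Real.rpow_neg (by positivity), ← Real.inv_rpow (by positivity), inv_inv,
      Real.mul_rpow (by norm_num) hx0.le]
  have h4 : t ^ (-q) * ∑ n ∈ Finset.range N, (2 : ℝ) ^ (-(n * q)) * lqSum ν n q ≤
      2 ^ q * x ^ q * G := by
    rw [h3]; exact mul_le_mul_of_nonneg_left (hsum N) (by positivity)
  have h5 : 1 ≤ x ^ q := Real.one_le_rpow hx1 hq.le
  nlinarith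

end KreinFeller
end

/-! ### Convexity of the growth rates of the `L^q`-sums. -/

noncomputable section

namespace KreinFeller

/-- Logarithmic convexity of power sums. -/
theorem sum_rpow_le_interpolate {ι : Type*} (s : Finset ι) {w : ι → ℝ} (hw : ∀ i ∈ s, 0 < w i)
    {a b t : ℝ} (ht : t ∈ Icc (0 : ℝ) 1) :
    ∑ i ∈ s, w i ^ ((1 - t) * a + t * b) ≤
      (∑ i ∈ s, w i ^ a) ^ (1 - t) * (∑ i ∈ s, w i ^ b) ^ t := by
  rcases ht.1.eq_or_lt with rfl | ht0
  · simp
  rcases ht.2.eq_or_lt with rfl | ht1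
  · simp
  have h1t : 0 < 1 - t := sub_pos.2 ht1
  have hpq : (1 - t)⁻¹.HolderConjugate t⁻¹ :=
    Real.holderConjugate_iff.2 ⟨(one_lt_inv₀ h1t).2 (by linarith), by rw [inv_inv, inv_inv]; ring⟩
  have h := Real.inner_le_Lp_mul_Lq_of_nonneg s hpq
    (f := fun i => w i ^ ((1 - t) * a)) (g := fun i => w i ^ (t * b))
    (fun i hi => (Real.rpow_pos_of_pos (hw i hi) _).le)
    (fun i hi => (Real.rpow_pos_of_pos (hw i hi) _).le)
  simp only [one_div, inv_inv] at h
  refine le_trans (Finset.sum_le_sum fun i hi => (Real.rpow_add (hw i hi) _ _).le) (h.trans_eq ?_)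
  congr 2
  · refine Finset.sum_congr rfl fun i hi => ?_
    rw [← Real.rpow_mul (hw i hi).le]
    congr 1
    field_simp
  · refine Finset.sum_congr rfl fun i hi => ?_
    rw [← Real.rpow_mul (hw i hi).le]
    congr 1
    field_simp

variable (ν : Measure ℝ)

/-- The `L^q`-sums grow at most like `2^(nr)`. -/
def HasLqRate (q r : ℝ) : Prop :=
  ∃ C : ℝ, ∀ n : ℕ, lqSum ν n q ≤ C * 2 ^ (n * r)

theorem hasLqRate_zero_one : HasLqRate ν 0 1 := by
  classical
  refine ⟨1, fun n => ?_⟩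
  have h := Finset.card_filter_le (Finset.range (2 ^ n)) fun k => 0 < ν (dyadic n k)
  rw [Finset.card_range] at h
  simp only [lqSum, Real.rpow_zero, Finset.sum_const, nsmul_eq_mul, mul_one, one_mul,
    Real.rpow_natCast]
  exact_mod_cast h

theorem pairwise_disjoint_dyadic (n : ℕ) : Pairwise (Function.onFun Disjoint (dyadic n)) :=
  fun _ _ hne => Set.disjoint_left.2 fun _ hx hx' => hne (eq_of_mem_dyadic hx hx')

variable [IsFiniteMeasure ν]

theorem sum_measureReal_dyadic_le (n : ℕ) (s : Finset ℕ) :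
    ∑ k ∈ s, ν.real (dyadic n k) ≤ ν.real univ := by
  rw [← measureReal_biUnion_finset (fun i _ j _ hij => pairwise_disjoint_dyadic n hij)
    fun k _ => measurableSet_dyadic n k]
  exact measureReal_mono (subset_univ _)

theorem hasLqRate_one_zero : HasLqRate ν 1 0 := by
  refine ⟨ν.real univ, fun n => ?_⟩
  simp only [lqSum, Real.rpow_one, mul_zero, Real.rpow_zero, mul_one]
  exact sum_measureReal_dyadic_le ν n _

variable {ν}

theorem HasLqRate.interpolate {a b ra rb t : ℝ} (ha : HasLqRate ν a ra) (hb : HasLqRate ν b rb)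
    (ht : t ∈ Icc (0 : ℝ) 1) :
    HasLqRate ν ((1 - t) * a + t * b) ((1 - t) * ra + t * rb) := by
  obtain ⟨A, hA⟩ := ha
  obtain ⟨B, hB⟩ := hb
  have hA0 : 0 ≤ A := by
    have := (lqSum_nonneg ν 0 a).trans (hA 0)
    simpa using this
  have hB0 : 0 ≤ B := by
    have := (lqSum_nonneg ν 0 b).trans (hB 0)
    simpa using this
  refine ⟨A ^ (1 - t) * B ^ t, fun n => ?_⟩
  have h1 := sum_rpow_le_interpolate
    ((Finset.range (2 ^ n)).filter fun k => 0 < ν (dyadic n k))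
    (w := fun k => ν.real (dyadic n k)) (a := a) (b := b)
    (fun k hk => ENNReal.toReal_pos (Finset.mem_filter.1 hk).2.ne' (measure_ne_top _ _)) ht
  refine h1.trans ?_
  have h2 := Real.rpow_le_rpow (lqSum_nonneg ν n a) (hA n) (sub_nonneg.2 ht.2)
  have h3 := Real.rpow_le_rpow (lqSum_nonneg ν n b) (hB n) ht.1
  refine (mul_le_mul h2 h3 (Real.rpow_nonneg (lqSum_nonneg ν n b) _) (by positivity)).trans_eq ?_
  rw [Real.mul_rpow hA0 (by positivity), Real.mul_rpow hB0 (by positivity),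
    ← Real.rpow_mul two_pos.le, ← Real.rpow_mul two_pos.le, mul_mul_mul_comm,
    ← Real.rpow_add two_pos]
  congr 2
  ring

/-- The chord between the trivial bounds: `2^n` intervals at exponent `0`, total mass at exponent
`1`. -/
theorem hasLqRate_of_mem_Icc {p : ℝ} (hp : p ∈ Icc (0 : ℝ) 1) : HasLqRate ν p (1 - p) := by
  simpa using (hasLqRate_zero_one ν).interpolate (hasLqRate_one_zero ν) hp

/-- If the growth rate of the `L^q`-sums is not maximal at one point, then it is not maximal at any
interior point. -/
theorem HasLqRate.exists_lt {p q r : ℝ} (hr : r < 1 - p)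
    (h : HasLqRate ν p r) (hq : q ∈ Ioo (0 : ℝ) 1) : ∃ r' < 1 - q, HasLqRate ν q r' := by
  rcases le_or_gt p q with hpq | hpq
  -- Interpolate between `p` and whichever endpoint, `1` here and `0` in the other case, lies on the
  -- far side of `q`. As `q` is interior, `p` keeps positive weight and the strict inequality
  -- survives.
  · have h1p : 0 < 1 - p := by linarith [hq.2]
    set t := (q - p) / (1 - p) with ht
    have ht0 : 0 ≤ t := div_nonneg (sub_nonneg.2 hpq) h1p.le
    have ht1 : t < 1 := by rw [ht, div_lt_one h1p]; linarith [hq.2]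
    have htq : (1 - t) * p + t * 1 = q := by rw [ht]; field_simp; ring
    refine ⟨(1 - t) * r + t * 0, ?_, ?_⟩
    · have : (1 - t) * r < (1 - t) * (1 - p) := mul_lt_mul_of_pos_left hr (sub_pos.2 ht1)
      linarith
    · rw [← htq]
      exact h.interpolate (hasLqRate_one_zero ν) ⟨ht0, ht1.le⟩
  · have hp0 : 0 < p := hq.1.trans hpq
    set t := q / p with ht
    have ht0 : 0 < t := div_pos hq.1 hp0
    have ht1 : t < 1 := by rw [ht, div_lt_one hp0]; exact hpq
    have htq : (1 - t) * 0 + t * p = q := by rw [ht]; field_simp; ring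
    refine ⟨(1 - t) * 1 + t * r, ?_, ?_⟩
    · have : t * r < t * (1 - p) := mul_lt_mul_of_pos_left hr ht0
      linarith
    · rw [← htq]
      exact (hasLqRate_zero_one ν).interpolate h ⟨ht0.le, ht1.le⟩

/-- Take logarithms; level `0` is excluded because the divisor would be `log 1 = 0`. -/
theorem lqLevel_le_iff {n : ℕ} (hn : n ≠ 0) {q r : ℝ} (hq : 0 ≤ q) :
    lqLevel ν n q ≤ (r : EReal) ↔ lqSum ν n q ≤ 2 ^ (n * r) := by
  have hl : 0 < Real.log (2 ^ n) := Real.log_pos (one_lt_pow₀ one_lt_two hn)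
  have hsum : ∑ k ∈ Finset.range (2 ^ n) with 0 < ν (dyadic n k), ν (dyadic n k) ^ q =
      ENNReal.ofReal (lqSum ν n q) := by
    rw [lqSum, ENNReal.ofReal_sum_of_nonneg fun k _ => Real.rpow_nonneg measureReal_nonneg _]
    refine Finset.sum_congr rfl fun k _ => ?_
    rw [← ENNReal.ofReal_rpow_of_nonneg measureReal_nonneg hq, ofReal_measureReal]
  have hpow : (0 : ℝ) < 2 ^ (n * r) := by positivity
  have hmul : ((Real.log (2 ^ n) : ℝ) : EReal) * (r : EReal) =
      ENNReal.log (ENNReal.ofReal (2 ^ (n * r))) := by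
    rw [ENNReal.log_ofReal_of_pos hpow, Real.log_rpow two_pos, Real.log_pow, ← EReal.coe_mul]
    congr 1
    ring
  rw [lqLevel, EReal.div_le_iff_le_mul (by exact_mod_cast hl) (EReal.coe_ne_top _), hmul,
    ENNReal.log_le_log_iff]
  have key := ENNReal.ofReal_le_ofReal_iff (p := lqSum ν n q) hpow.le
  rw [← hsum] at key
  convert key

theorem hasLqRate_of_lqSpectrum_lt {q r : ℝ} (hq : 0 ≤ q) (h : lqSpectrum ν q < (r : EReal)) :
    HasLqRate ν q r := by
  have h1 : ∀ᶠ n : ℕ in atTop, lqLevel ν n q < (r : EReal) :=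
    eventually_lt_of_limsup_lt h (by isBoundedDefault)
  obtain ⟨N, hN⟩ := eventually_atTop.1 (h1.and (eventually_ne_atTop 0))
  -- The limsup controls only levels from `N` on; the sum absorbs the finitely many earlier ones.
  refine ⟨1 + ∑ n ∈ Finset.range N, lqSum ν n q * 2 ^ (-(n * r)), fun n => ?_⟩
  have hpos : (0 : ℝ) < 2 ^ (n * r) := by positivity
  have hterm : ∀ i : ℕ, 0 ≤ lqSum ν i q * 2 ^ (-(i * r)) := fun i =>
    mul_nonneg (lqSum_nonneg ν i q) (by positivity)
  have hS := Finset.sum_nonneg fun i (_ : i ∈ Finset.range N) => hterm i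
  rcases le_or_gt N n with hn | hn
  · obtain ⟨h2, h3⟩ := hN n hn
    have h4 := (lqLevel_le_iff h3 hq).1 h2.le
    nlinarith
  · have h5 := Finset.single_le_sum (fun i _ => hterm i) (Finset.mem_range.2 hn)
    have h6 : lqSum ν n q = lqSum ν n q * 2 ^ (-(n * r)) * 2 ^ (n * r) := by
      rw [mul_assoc, ← Real.rpow_add two_pos]; simp
    rw [h6]
    exact mul_le_mul_of_nonneg_right (h5.trans (by linarith)) hpos.le

theorem HasLqRate.lqSpectrum_le {q r : ℝ} (hq : 0 ≤ q) (h : HasLqRate ν q r) :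
    lqSpectrum ν q ≤ (r : EReal) := by
  obtain ⟨C, hC⟩ := h
  refine EReal.le_of_forall_lt_iff_le.1 fun z hz => ?_
  have hz' : 0 < z - r := sub_pos.2 (EReal.coe_lt_coe_iff.1 hz)
  refine limsup_le_of_le (by isBoundedDefault) ?_
  have h1 : Tendsto (fun n : ℕ => (2 ^ (z - r) : ℝ) ^ n) atTop atTop :=
    tendsto_pow_atTop_atTop_of_one_lt (Real.one_lt_rpow one_lt_two hz')
  filter_upwards [h1.eventually_ge_atTop C, eventually_ne_atTop 0] with n hn hn0
  rw [lqLevel_le_iff hn0 hq]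
  refine (hC n).trans ((mul_le_mul_of_nonneg_right hn (by positivity)).trans_eq ?_)
  rw [← Real.rpow_natCast, ← Real.rpow_mul two_pos.le, ← Real.rpow_add two_pos]
  congr 1
  ring

theorem exists_hasLqRate_of_lqSpectrum_ne {p : ℝ} (hp : p ∈ Icc (0 : ℝ) 1)
    (h : lqSpectrum ν p ≠ ((1 - p : ℝ) : EReal)) : ∃ r < 1 - p, HasLqRate ν p r := by
  have h1 := ((hasLqRate_of_mem_Icc (ν := ν) hp).lqSpectrum_le hp.1).lt_of_ne h
  obtain ⟨r, hr, hr'⟩ := EReal.lt_iff_exists_real_btwn.1 h1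
  exact ⟨r, EReal.coe_lt_coe_iff.1 hr', hasLqRate_of_lqSpectrum_lt hp.1 hr⟩

/-- The strict inequality is moved to exponent `1/2` and leaves room to decrease the exponent to
some `t/2 < 1/2` at which the rate is still below the exponent. -/
theorem upperSpectralDim_lt_half_of_lqSpectrum_ne {p : ℝ} (hp : p ∈ Icc (0 : ℝ) 1)
    (h : lqSpectrum ν p ≠ ((1 - p : ℝ) : EReal)) :
    upperSpectralDim ν < ((1 / 2 : ℝ) : EReal) := by
  obtain ⟨r, hr, hrate⟩ := exists_hasLqRate_of_lqSpectrum_ne hp h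
  obtain ⟨r', hr', hrate'⟩ := hrate.exists_lt hr (q := 1 / 2) (by norm_num)
  -- At exponent `t/2` the rate is `(1 - t) + t r'`, which is below `t/2` exactly when `t (3/2 - r')
  -- > 1`. As `r' < 1/2`, some `t < 1` satisfies this; the bound `1/2 < t` only ensures positivity.
  obtain ⟨t, ht, ht1⟩ := exists_between (max_lt (inv_lt_one_of_one_lt₀ (by linarith :
    1 < 3 / 2 - r')) one_half_lt_one)
  have ht0 : 0 < t := one_half_pos.trans ((le_max_right _ _).trans_lt ht)
  have htr : 1 < t * (3 / 2 - r') := by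
    have := (le_max_left _ _).trans_lt ht
    rwa [inv_lt_iff_one_lt_mul₀ (by linarith)] at this
  have h1 := (hasLqRate_zero_one ν).interpolate hrate' ⟨ht0.le, ht1.le⟩
  obtain ⟨C, hC⟩ := h1
  refine (upperSpectralDim_le_of_lqSum_le ν (by linarith) (by linarith) hC).trans_lt ?_
  rw [EReal.coe_lt_coe_iff]
  linarith

/-- For `q` in `(1/2, 1]` the rate `1 - q`, always available, is below `q`. -/
theorem upperSpectralDim_le_half : upperSpectralDim ν ≤ ((1 / 2 : ℝ) : EReal) := by
  refine EReal.le_of_forall_lt_iff_le.1 fun z hz => ?_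
  have hz' : 1 / 2 < z := EReal.coe_lt_coe_iff.1 hz
  have hm : 1 / 2 < min z 1 := lt_min hz' one_half_lt_one
  obtain ⟨C, hC⟩ := hasLqRate_of_mem_Icc (ν := ν) (p := min z 1) ⟨by linarith, min_le_right _ _⟩
  refine (upperSpectralDim_le_of_lqSum_le ν (by linarith) (by linarith) hC).trans ?_
  exact_mod_cast min_le_left _ _

end KreinFeller
end

/-! ### Trapezoidal test functions on dyadic intervals. -/

noncomputable section

namespace KreinFeller

theorem integral_indicator_dyadic_of_le {n k : ℕ} {x : ℝ} (hx : 0 ≤ x) (h : x ≤ k / 2 ^ n) :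
    ∫ t in (0 : ℝ)..x, (dyadic n k).indicator (fun _ => (2 : ℝ) ^ n) t = 0 := by
  rw [dyadic, integral_indicator_Ioc (by positivity) hx,
    Ioc_eq_empty (not_lt.2 ((min_le_left _ _).trans h)), setIntegral_empty]

theorem integral_indicator_dyadic_of_ge {n k : ℕ} {x : ℝ} (h : ((k : ℝ) + 1) / 2 ^ n ≤ x) :
    ∫ t in (0 : ℝ)..x, (dyadic n k).indicator (fun _ => (2 : ℝ) ^ n) t = 1 := by
  rw [dyadic, integral_indicator_Ioc (by positivity) (le_trans (by positivity) h),
    min_eq_right h, setIntegral_const, smul_eq_mul, measureReal_def, Real.volume_Ioc,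
    ENNReal.toReal_ofReal (by rw [sub_nonneg]; gcongr; linarith)]
  field_simp
  ring

/-- The derivative of the hat function which is `1` on the dyadic interval with index `k + 1` and
vanishes outside of this interval and its neighbours. -/
def hatDeriv (n k : ℕ) (t : ℝ) : ℝ :=
  (dyadic n k).indicator (fun _ => (2 : ℝ) ^ n) t -
    (dyadic n (k + 2)).indicator (fun _ => (2 : ℝ) ^ n) t

theorem memLp_indicator_dyadic (n k : ℕ) :
    MemLp ((dyadic n k).indicator fun _ => (2 : ℝ) ^ n) 2 (volume.restrict (Icc (0 : ℝ) 1)) :=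
  (memLp_const _).indicator (measurableSet_dyadic n k)

theorem memLp_hatDeriv (n k : ℕ) : MemLp (hatDeriv n k) 2 (volume.restrict (Icc (0 : ℝ) 1)) :=
  (memLp_indicator_dyadic n k).sub (memLp_indicator_dyadic n (k + 2))

theorem integral_hatDeriv (n k : ℕ) {x : ℝ} (hx : x ∈ Icc (0 : ℝ) 1) :
    ∫ t in (0 : ℝ)..x, hatDeriv n k t =
      (∫ t in (0 : ℝ)..x, (dyadic n k).indicator (fun _ => (2 : ℝ) ^ n) t) -
        ∫ t in (0 : ℝ)..x, (dyadic n (k + 2)).indicator (fun _ => (2 : ℝ) ^ n) t :=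
  intervalIntegral.integral_sub
    (IntegrableOn.intervalIntegrable_of_unit
      ((memLp_indicator_dyadic n k).integrable (by norm_num)) (by simp) hx)
    (IntegrableOn.intervalIntegrable_of_unit
      ((memLp_indicator_dyadic n (k + 2)).integrable (by norm_num)) (by simp) hx)

theorem add_one_div_le_of_le {n k l : ℕ} (h : k + 1 ≤ l) :
    ((k : ℝ) + 1) / 2 ^ n ≤ (l : ℝ) / 2 ^ n := by
  gcongr
  exact_mod_cast h

theorem dyadic_subset_unit {n k : ℕ} (hk : k + 1 ≤ 2 ^ n) : dyadic n k ⊆ Ioc 0 1 := by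
  intro x hx
  refine ⟨lt_of_le_of_lt (by positivity) hx.1, hx.2.trans (div_le_one_of_le₀ ?_ (by positivity))⟩
  exact_mod_cast hk

theorem integral_hatDeriv_one {n k : ℕ} (hk : k + 3 ≤ 2 ^ n) :
    ∫ t in (0 : ℝ)..1, hatDeriv n k t = 0 := by
  have h1 : ∀ j : ℕ, j + 1 ≤ 2 ^ n → ((j : ℝ) + 1) / 2 ^ n ≤ 1 := fun j hj =>
    div_le_one_of_le₀ (by exact_mod_cast hj) (by positivity)
  rw [integral_hatDeriv n k (by simp), integral_indicator_dyadic_of_ge (h1 k (by omega)),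
    integral_indicator_dyadic_of_ge (h1 (k + 2) (by omega)), sub_self]

/-- The class of the derivative of the hat function in `L²([0,1])`. -/
def hatDerivL2 (n k : ℕ) : UnitL2 := (memLp_hatDeriv n k).toLp

/-- The `k`-th bump rises on interval `k`, equals `1` on `k + 1` and falls on `k + 2`. On the
plateau of a bump at index distance at least `3`, its two slopes are both still ahead or both
completed, so it vanishes. -/
theorem primitiveₗ_hatDerivL2 {n k j : ℕ} (hk : k + 3 ≤ 2 ^ n) (hj : j + 3 ≤ 2 ^ n) {x : ℝ}
    (hx : x ∈ dyadic n (j + 1)) :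
    (j = k → primitiveₗ (hatDerivL2 n k) x = 1) ∧
      (j + 3 ≤ k ∨ k + 3 ≤ j → primitiveₗ (hatDerivL2 n k) x = 0) := by
  have hx01 := Ioc_subset_Icc_self (dyadic_subset_unit (by omega) hx)
  have hval : primitiveₗ (hatDerivL2 n k) x = ∫ t in (0 : ℝ)..x, hatDeriv n k t := by
    rw [primitiveₗ_apply, hatDerivL2, meanFreePrimitive_congr (memLp_hatDeriv n k).coeFn_toLp,
      meanFreePrimitive_of_mem hx01, integral_hatDeriv_one hk, mul_zero, sub_zero]
  have hlow : ∀ l, l ≤ j + 1 → (l : ℝ) / 2 ^ n ≤ x := fun l hl =>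
    (by gcongr : (l : ℝ) / 2 ^ n ≤ ((j + 1 : ℕ) : ℝ) / 2 ^ n).trans hx.1.le
  have hup : ∀ l, j + 2 ≤ l → x ≤ (l : ℝ) / 2 ^ n := fun l hl =>
    hx.2.trans (add_one_div_le_of_le hl)
  rw [hval, integral_hatDeriv n k hx01]
  refine ⟨?_, ?_⟩
  · rintro rfl
    rw [integral_indicator_dyadic_of_ge (by exact_mod_cast hlow (j + 1) le_rfl),
      integral_indicator_dyadic_of_le hx01.1 (hup _ le_rfl), sub_zero]
  · rintro (h | h)
    · rw [integral_indicator_dyadic_of_le hx01.1 (hup _ (by omega)),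
        integral_indicator_dyadic_of_le hx01.1 (hup _ (by omega)), sub_zero]
    · rw [integral_indicator_dyadic_of_ge (by exact_mod_cast hlow (k + 1) (by omega)),
        integral_indicator_dyadic_of_ge (by exact_mod_cast hlow (k + 2 + 1) (by omega)), sub_self]

theorem inner_hatDerivL2 (n k j : ℕ) :
    inner ℝ (hatDerivL2 n k) (hatDerivL2 n j) =
      ∫ t in (0 : ℝ)..1, hatDeriv n k t * hatDeriv n j t := by
  rw [UnitL2.inner_eq]
  refine integral_unit_congr_ae ?_ (by simp)
  filter_upwards [(memLp_hatDeriv n k).coeFn_toLp, (memLp_hatDeriv n j).coeFn_toLp] with t h1 h2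
  rw [hatDerivL2, hatDerivL2, h1, h2]

theorem inner_hatDerivL2_of_far {n k j : ℕ} (h : j + 3 ≤ k ∨ k + 3 ≤ j) :
    inner ℝ (hatDerivL2 n k) (hatDerivL2 n j) = 0 := by
  rw [inner_hatDerivL2]
  have : ∀ t, hatDeriv n k t * hatDeriv n j t = 0 := by
    intro t
    have hne : ∀ a b, a ≠ b → (dyadic n a).indicator (fun _ => (2 : ℝ) ^ n) t *
        (dyadic n b).indicator (fun _ => (2 : ℝ) ^ n) t = 0 := by
      intro a b hab
      by_cases ha : t ∈ dyadic n a
      · rw [indicator_of_notMem fun hb => hab (eq_of_mem_dyadic ha hb), mul_zero]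
      · rw [indicator_of_notMem ha, zero_mul]
    rw [hatDeriv, hatDeriv]
    linear_combination hne k j (by omega) - hne k (j + 2) (by omega) - hne (k + 2) j (by omega) +
      hne (k + 2) (j + 2) (by omega)
  simp [this]

/-- Each of the two slopes contributes `(2^n)² · 2^(-n)`. -/
theorem norm_sq_hatDerivL2 {n k : ℕ} (hk : k + 3 ≤ 2 ^ n) :
    ‖hatDerivL2 n k‖ ^ 2 = 2 * 2 ^ n := by
  rw [← real_inner_self_eq_norm_sq, inner_hatDerivL2]
  have h1 : ∀ t, hatDeriv n k t * hatDeriv n k t =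
      2 ^ n * ((dyadic n k).indicator (fun _ => (2 : ℝ) ^ n) t +
        (dyadic n (k + 2)).indicator (fun _ => (2 : ℝ) ^ n) t) := by
    intro t
    simp only [hatDeriv, indicator]
    split_ifs with h1 h2
    · have := eq_of_mem_dyadic h1 h2; omega
    all_goals ring
  have hle : ∀ j : ℕ, j + 1 ≤ 2 ^ n → ((j : ℝ) + 1) / 2 ^ n ≤ 1 := fun j hj =>
    div_le_one_of_le₀ (by exact_mod_cast hj) (by positivity)
  simp only [h1]
  rw [intervalIntegral.integral_const_mul, intervalIntegral.integral_add
    (IntegrableOn.intervalIntegrable_of_unit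
      ((memLp_indicator_dyadic n k).integrable (by norm_num)) (by simp) (by simp))
    (IntegrableOn.intervalIntegrable_of_unit
      ((memLp_indicator_dyadic n (k + 2)).integrable (by norm_num)) (by simp) (by simp)),
    integral_indicator_dyadic_of_ge (hle k (by omega)),
    integral_indicator_dyadic_of_ge (hle (k + 2) (by omega))]
  ring

variable {ν : Measure ℝ} [IsFiniteMeasure ν]

/-- Separated dyadic intervals of large mass produce eigenvalues. -/
theorem card_le_countingFunction_of_separated {n : ℕ} (B : Finset ℕ) {θ x : ℝ} (hθ : 0 < θ)
    (hB : ∀ k ∈ B, k + 3 ≤ 2 ^ n) (hsep : ∀ k ∈ B, ∀ j ∈ B, k ≠ j → j + 3 ≤ k ∨ k + 3 ≤ j)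
    (hmass : ∀ k ∈ B, θ ≤ ν.real (dyadic n (k + 1))) (hx : 2 * 2 ^ n < x * θ) :
    (B.card : ℝ≥0∞) ≤ countingFunction ν x := by
  have hx0 : 0 < x := by
    have : 0 < x * θ := lt_trans (by positivity) hx
    exact (pos_iff_pos_of_mul_pos this).2 hθ
  let κ : Fin B.card → ℕ := fun i => B.equivFin.symm i
  have hκ : ∀ i, κ i ∈ B := fun i => (B.equivFin.symm i).2
  have hκinj : Function.Injective κ :=
    Subtype.val_injective.comp B.equivFin.symm.injective
  have hfar : ∀ i j, i ≠ j → κ j + 3 ≤ κ i ∨ κ i + 3 ≤ κ j := fun i j hij =>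
    hsep _ (hκ i) _ (hκ j) (hκinj.ne hij)
  -- The derivatives of separated bumps are orthogonal, so the norm is diagonal in `c`; the `ν`-form
  -- is bounded below by integrating over the plateaus alone.
  let φ : (Fin B.card → ℝ) →ₗ[ℝ] UnitL2 :=
    Fintype.linearCombination ℝ fun i => hatDerivL2 n (κ i)
  refine natCast_le_countingFunction hx0 φ fun c hc => ?_
  have hφ : φ c = ∑ i, c i • hatDerivL2 n (κ i) := rfl
  have hpos : 0 < ∑ i, c i ^ 2 := by
    obtain ⟨i, hi⟩ := Function.ne_iff.1 hc
    exact Finset.sum_pos' (fun j _ => sq_nonneg _) ⟨i, Finset.mem_univ i, by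
      have : c i ≠ 0 := hi
      positivity⟩
  have hnorm : ‖φ c‖ ^ 2 = 2 * 2 ^ n * ∑ i, c i ^ 2 := by
    rw [← real_inner_self_eq_norm_sq, hφ, sum_inner, Finset.mul_sum]
    refine Finset.sum_congr rfl fun i _ => ?_
    rw [inner_sum, Finset.sum_eq_single_of_mem i (Finset.mem_univ i) fun j _ hj => ?_]
    · rw [inner_smul_left, inner_smul_right, real_inner_self_eq_norm_sq,
        norm_sq_hatDerivL2 (hB _ (hκ i))]
      simp only [conj_trivial]
      ring
    · rw [inner_smul_left, inner_smul_right, inner_hatDerivL2_of_far (hfar i j hj.symm), mul_zero,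
        mul_zero]
  have hprim : ∀ i, ∀ y ∈ dyadic n (κ i + 1), primitiveₗ (φ c) y = c i := by
    intro i y hy
    rw [hφ, map_sum, Finset.sum_apply,
      Finset.sum_eq_single_of_mem i (Finset.mem_univ i) fun j _ hj => ?_]
    · rw [map_smul, Pi.smul_apply,
        (primitiveₗ_hatDerivL2 (hB _ (hκ i)) (hB _ (hκ i)) hy).1 rfl, smul_eq_mul, mul_one]
    · rw [map_smul, Pi.smul_apply,
        (primitiveₗ_hatDerivL2 (hB _ (hκ j)) (hB _ (hκ i)) hy).2 (hfar j i hj), smul_zero]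
  have hfint := integrable_mul ν (primitiveₗ_mem_H10 (φ c)) (primitiveₗ_mem_H10 (φ c))
  have hinner : θ * ∑ i, c i ^ 2 ≤ innerNu ν (primitiveₗ (φ c)) (primitiveₗ (φ c)) := by
    calc θ * ∑ i, c i ^ 2
        ≤ ∑ i, ∫ y in dyadic n (κ i + 1), primitiveₗ (φ c) y * primitiveₗ (φ c) y ∂ν := by
          rw [Finset.mul_sum]
          refine Finset.sum_le_sum fun i _ => ?_
          have : ∫ y in dyadic n (κ i + 1), primitiveₗ (φ c) y * primitiveₗ (φ c) y ∂ν =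
              ∫ y in dyadic n (κ i + 1), c i ^ 2 ∂ν :=
            setIntegral_congr_fun (measurableSet_dyadic _ _) fun y hy => by
              simp only [hprim i y hy, sq]
          rw [this, setIntegral_const, smul_eq_mul]
          exact mul_le_mul_of_nonneg_right (hmass _ (hκ i)) (sq_nonneg _)
      _ = ∫ y in ⋃ i ∈ (Finset.univ : Finset (Fin B.card)), dyadic n (κ i + 1),
            primitiveₗ (φ c) y * primitiveₗ (φ c) y ∂ν := by
          refine (integral_biUnion_finset _ (fun i _ => measurableSet_dyadic _ _)
            (fun i _ j _ hij => ?_) fun i _ => hfint.integrableOn).symm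
          exact pairwise_disjoint_dyadic n fun h => hij (hκinj (Nat.succ_injective h))
      _ ≤ _ := setIntegral_le_integral hfint (Eventually.of_forall fun y => mul_self_nonneg _)
  calc ‖φ c‖ ^ 2 = 2 * 2 ^ n * ∑ i, c i ^ 2 := hnorm
    _ < x * θ * ∑ i, c i ^ 2 := mul_lt_mul_of_pos_right hx hpos
    _ = x * (θ * ∑ i, c i ^ 2) := mul_assoc _ _ _
    _ ≤ _ := mul_le_mul_of_nonneg_left hinner hx0.le

/-- Dyadic intervals of large mass produce eigenvalues. -/
theorem card_le_countingFunction {n : ℕ} (B : Finset ℕ) {θ x : ℝ} (hθ : 0 < θ)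
    (hB : ∀ k ∈ B, k < 2 ^ n) (hmass : ∀ k ∈ B, θ ≤ ν.real (dyadic n k))
    (hx : 2 * 2 ^ n < x * θ) :
    (B.card : ℝ≥0∞) ≤ 2 + 3 * countingFunction ν x := by
  -- Indices in one residue class modulo `3` are separated. The shift by one records that bump `k`
  -- has its plateau on interval `k + 1`; the first and last intervals carry no plateau and cost the
  -- additive `2`.
  let A : ℕ → Finset ℕ := fun r =>
    (Finset.range (2 ^ n)).filter fun k => k + 3 ≤ 2 ^ n ∧ k + 1 ∈ B ∧ k % 3 = r
  have hA : ∀ r, ((A r).card : ℝ≥0∞) ≤ countingFunction ν x := fun r => by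
    refine card_le_countingFunction_of_separated (A r) hθ
      (fun k hk => (Finset.mem_filter.1 hk).2.1) (fun k hk j hj hne => ?_)
      (fun k hk => hmass _ (Finset.mem_filter.1 hk).2.2.1) hx
    have h1 := (Finset.mem_filter.1 hk).2.2.2
    have h2 := (Finset.mem_filter.1 hj).2.2.2
    omega
  have hsub : B ⊆ {0, 2 ^ n - 1} ∪ ((A 0).image (· + 1) ∪ ((A 1).image (· + 1) ∪
      (A 2).image (· + 1))) := by
    intro k hk
    have hk2 := hB k hk
    simp only [Finset.mem_union, Finset.mem_insert, Finset.mem_singleton, Finset.mem_image, A,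
      Finset.mem_filter, Finset.mem_range]
    by_cases h : k = 0 ∨ k = 2 ^ n - 1
    · exact Or.inl h
    · right
      push Not at h
      obtain ⟨k, rfl⟩ := Nat.exists_eq_succ_of_ne_zero h.1
      have hlt : k + 3 ≤ 2 ^ n := by omega
      have h3 : k % 3 < 3 := Nat.mod_lt _ (by norm_num)
      have hcase : k % 3 = 0 ∨ k % 3 = 1 ∨ k % 3 = 2 := by omega
      rcases hcase with h0 | h0 | h0
      · exact Or.inl ⟨k, ⟨by omega, hlt, hk, h0⟩, rfl⟩
      · exact Or.inr (Or.inl ⟨k, ⟨by omega, hlt, hk, h0⟩, rfl⟩)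
      · exact Or.inr (Or.inr ⟨k, ⟨by omega, hlt, hk, h0⟩, rfl⟩)
  have hcard : B.card ≤ 2 + ((A 0).card + ((A 1).card + (A 2).card)) :=
    (Finset.card_le_card hsub).trans <| (Finset.card_union_le _ _).trans <|
      add_le_add Finset.card_le_two <| (Finset.card_union_le _ _).trans <|
        add_le_add Finset.card_image_le <| (Finset.card_union_le _ _).trans <|
          add_le_add Finset.card_image_le Finset.card_image_le
  calc (B.card : ℝ≥0∞) ≤ ((2 + ((A 0).card + ((A 1).card + (A 2).card)) : ℕ) : ℝ≥0∞) := by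
        exact_mod_cast hcard
    _ = 2 + ((A 0).card + ((A 1).card + (A 2).card)) := by push_cast; rfl
    _ ≤ 2 + (countingFunction ν x + (countingFunction ν x + countingFunction ν x)) := by
        gcongr <;> exact hA _
    _ = 2 + 3 * countingFunction ν x := by ring

end KreinFeller
end

/-! ### Many heavy intervals and the bound on the lower spectral dimension. -/

noncomputable section

namespace KreinFeller

variable {ν : Measure ℝ} [IsFiniteMeasure ν]

/-- Split at mass `θ`: each light interval contributes at most `θ^q`, and Hölder bounds the heavy
part by its cardinality and the total mass. -/
theorem lqSum_le_of_card {n : ℕ} {q θ : ℝ} (hq : q ∈ Icc (0 : ℝ) 1)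
    (hθ : 0 < θ) :
    lqSum ν n q ≤ 2 ^ n * θ ^ q +
      (((Finset.range (2 ^ n)).filter fun k => θ ≤ ν.real (dyadic n k)).card : ℝ) ^ (1 - q) *
        (ν.real univ + 1) ^ q := by
  classical
  set H := (Finset.range (2 ^ n)).filter fun k => θ ≤ ν.real (dyadic n k) with hH
  have h1 : lqSum ν n q ≤ ∑ k ∈ Finset.range (2 ^ n), θ ^ q + ∑ k ∈ H, ν.real (dyadic n k) ^ q := by
    rw [lqSum, hH, Finset.sum_filter, Finset.sum_filter, ← Finset.sum_add_distrib]
    refine Finset.sum_le_sum fun k _ => ?_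
    have h0 : 0 ≤ ν.real (dyadic n k) ^ q := Real.rpow_nonneg measureReal_nonneg _
    have hθq : 0 ≤ θ ^ q := Real.rpow_nonneg hθ.le _
    split_ifs with h2 h3 h3
    · linarith
    · have := Real.rpow_le_rpow measureReal_nonneg (not_le.1 h3).le hq.1
      linarith
    · linarith
    · linarith
  have h2 := sum_rpow_le_interpolate H (w := fun k => ν.real (dyadic n k)) (a := 0) (b := 1)
    (fun k hk => hθ.trans_le (Finset.mem_filter.1 hk).2) hq
  simp only [mul_zero, mul_one, zero_add, Real.rpow_zero, Real.rpow_one, Finset.sum_const,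
    nsmul_eq_mul] at h2
  have h3 : (∑ k ∈ H, ν.real (dyadic n k)) ^ q ≤ (ν.real univ + 1) ^ q := by
    refine Real.rpow_le_rpow (Finset.sum_nonneg fun _ _ => measureReal_nonneg) ?_ hq.1
    have := sum_measureReal_dyadic_le ν n H
    linarith
  refine h1.trans (add_le_add (by simp) (h2.trans (mul_le_mul_of_nonneg_left h3 (by positivity))))

/-- Maximal growth of the `L^q`-sums forces many dyadic intervals of large mass. -/
theorem eventually_rpow_le_card_heavy {q η : ℝ} (hq : q ∈ Ioo (0 : ℝ) 1) (hη : 0 < η)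
    (h : ∀ δ > 0, ∀ᶠ n : ℕ in atTop, (2 : ℝ) ^ (n * (1 - q - δ)) ≤ lqSum ν n q) :
    ∀ᶠ n : ℕ in atTop, (2 : ℝ) ^ (n * (1 - η)) ≤
      ((Finset.range (2 ^ n)).filter fun k =>
        (2 : ℝ) ^ (-(n * (1 + η))) ≤ ν.real (dyadic n k)).card := by
  have h1q : 0 < 1 - q := sub_pos.2 hq.2
  -- This `δ` is below both `q η` and `(1 - q) η`, so if there were too few heavy intervals, both
  -- parts of the split would be exponentially smaller than `2^(n(1 - q - δ))`.
  set δ := q * (1 - q) * η with hδ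
  have hδ0 : 0 < δ := mul_pos (mul_pos hq.1 h1q) hη
  have hδ1 : δ - q * η < 0 := by
    have : q * η * (1 - q) < q * η * 1 :=
      mul_lt_mul_of_pos_left (by linarith [hq.1]) (mul_pos hq.1 hη)
    rw [hδ]; linarith
  have hδ2 : δ - (1 - q) * η < 0 := by
    have : (1 - q) * η * q < (1 - q) * η * 1 := mul_lt_mul_of_pos_left hq.2 (mul_pos h1q hη)
    rw [hδ]; linarith
  set ρ₁ : ℝ := 2 ^ (δ - q * η) with hρ₁
  set ρ₂ : ℝ := 2 ^ (δ - (1 - q) * η) with hρ₂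
  set M : ℝ := (ν.real univ + 1) ^ q with hM
  have ht1 : Tendsto (fun n : ℕ => ρ₁ ^ n) atTop (𝓝 0) :=
    tendsto_pow_atTop_nhds_zero_of_lt_one (by positivity)
      (Real.rpow_lt_one_of_one_lt_of_neg one_lt_two hδ1)
  have ht2 : Tendsto (fun n : ℕ => ρ₂ ^ n) atTop (𝓝 0) :=
    tendsto_pow_atTop_nhds_zero_of_lt_one (by positivity)
      (Real.rpow_lt_one_of_one_lt_of_neg one_lt_two hδ2)
  have ht : Tendsto (fun n : ℕ => ρ₁ ^ n + ρ₂ ^ n * M) atTop (𝓝 0) := by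
    simpa using ht1.add (ht2.mul_const M)
  filter_upwards [h δ hδ0, ht.eventually_lt_const one_pos] with n hn hlt
  by_contra! hcon
  set H := (Finset.range (2 ^ n)).filter fun k =>
    (2 : ℝ) ^ (-(n * (1 + η))) ≤ ν.real (dyadic n k) with hH
  have hθ : (0 : ℝ) < 2 ^ (-(n * (1 + η))) := by positivity
  have h1 := lqSum_le_of_card (ν := ν) (n := n) (Ioo_subset_Icc_self hq) hθ
  rw [← hH, ← hM] at h1
  have hM0 : 0 ≤ M := Real.rpow_nonneg (add_nonneg measureReal_nonneg zero_le_one) _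
  have h2 : (H.card : ℝ) ^ (1 - q) ≤ (2 ^ (n * (1 - η))) ^ (1 - q) :=
    Real.rpow_le_rpow (Nat.cast_nonneg _) hcon.le h1q.le
  set X : ℝ := 2 ^ (n * (1 - q - δ)) with hX
  have hX0 : 0 < X := by positivity
  have h3 : (2 : ℝ) ^ n * (2 ^ (-(n * (1 + η)))) ^ q = X * ρ₁ ^ n := by
    rw [hX, hρ₁, ← Real.rpow_natCast 2 n, ← Real.rpow_natCast _ n, ← Real.rpow_mul two_pos.le,
      ← Real.rpow_mul two_pos.le, ← Real.rpow_add two_pos, ← Real.rpow_add two_pos]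
    congr 1
    ring
  have h4 : ((2 : ℝ) ^ (n * (1 - η))) ^ (1 - q) = X * ρ₂ ^ n := by
    rw [hX, hρ₂, ← Real.rpow_natCast _ n, ← Real.rpow_mul two_pos.le,
      ← Real.rpow_mul two_pos.le, ← Real.rpow_add two_pos]
    congr 1
    ring
  rw [h3] at h1
  rw [h4] at h2
  have h5 := mul_le_mul_of_nonneg_right h2 hM0
  have h6 : X * (ρ₁ ^ n + ρ₂ ^ n * M) < X * 1 := mul_lt_mul_of_pos_left hlt hX0
  linarith

theorem half_le_lowerSpectralDim {q : ℝ} (hq : q ∈ Ioo (0 : ℝ) 1)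
    (h : ∀ δ > 0, ∀ᶠ n : ℕ in atTop, (2 : ℝ) ^ (n * (1 - q - δ)) ≤ lqSum ν n q) :
    ((1 / 2 : ℝ) : EReal) ≤ lowerSpectralDim ν := by
  refine EReal.ge_of_forall_gt_iff_ge.1 fun z hz => ?_
  have hz' : z < 1 / 2 := EReal.coe_lt_coe_iff.1 hz
  -- Raising `z` to at least `1/4` loses nothing and makes `s` positive.
  set s := max z (1 / 4) with hs
  have hzs : (z : EReal) ≤ (s : EReal) := by exact_mod_cast le_max_left _ _
  refine hzs.trans (le_lowerSpectralDim_of_eventually_le ν ?_)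
  have hs4 : 1 / 4 ≤ s := le_max_right _ _
  have hs2 : s < 1 / 2 := max_lt hz' (by norm_num)
  -- With this `η`, the requirement `s < (1 - η)/(2 + η)` reduces to `s < 1`.
  set η : ℝ := (1 - 2 * s) / 2 with hη
  have hη0 : 0 < η := by rw [hη]; linarith
  have h1η : 0 < 1 - η := by rw [hη]; linarith
  have h2η : 0 < 2 + η := by linarith
  set σ : ℝ := (1 - η) / (2 + η) with hσ
  have hσs : s < σ := by
    rw [hσ, lt_div_iff₀ h2η, hη]
    nlinarith
  -- `κ` collects the loss from the shift by `2` and from the rounding in `N`.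
  set κ : ℝ := 2 * σ + (1 - η) with hκ
  -- The finest level with `n (2 + η) ≤ log₂ x - 2`; the shift leaves room for the strict inequality
  -- `2 · 2^n < x · 2^(-n(1+η))`.
  let N : ℝ → ℕ := fun x => ⌊(Real.logb 2 x - 2) / (2 + η)⌋₊
  have hlogb : Tendsto (Real.logb 2) atTop atTop := Real.tendsto_logb_atTop one_lt_two
  have hN : Tendsto N atTop atTop :=
    tendsto_nat_floor_atTop.comp
      ((tendsto_atTop_add_const_right atTop (-2) hlogb).atTop_div_const h2η)
  have hbig : Tendsto (fun x : ℝ => (2 : ℝ) ^ (-κ) * x ^ (σ - s)) atTop atTop :=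
    (tendsto_rpow_atTop (sub_pos.2 hσs)).const_mul_atTop (by positivity)
  filter_upwards [hN.eventually (eventually_rpow_le_card_heavy hq hη0 h),
    -- The `5` beats `2 + 3 x^s ≤ 5 x^s`, the bound that would hold if the counting function were
    -- below `x^s`.
    hbig.eventually_gt_atTop 5, eventually_gt_atTop 1,
    hlogb.eventually_ge_atTop 2] with x hcard hx5 hx1 hxL
  have hx0 : 0 < x := one_pos.trans hx1
  set n := N x with hn
  set L := Real.logb 2 x with hL
  have hxL' : (2 : ℝ) ^ L = x := Real.rpow_logb two_pos (by norm_num) hx0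
  have hn1 : (n : ℝ) * (2 + η) ≤ L - 2 := by
    rw [← le_div_iff₀ h2η]
    exact Nat.floor_le (div_nonneg (sub_nonneg.2 hxL) h2η.le)
  have hn2 : (L - 2) / (2 + η) < n + 1 := Nat.lt_floor_add_one _
  have hcount := card_le_countingFunction (ν := ν) (n := n) (x := x)
    ((Finset.range (2 ^ n)).filter fun k => (2 : ℝ) ^ (-(n * (1 + η))) ≤ ν.real (dyadic n k))
    (by positivity : (0 : ℝ) < 2 ^ (-(n * (1 + η))))
    (fun k hk => Finset.mem_range.1 (Finset.mem_filter.1 hk).1)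
    (fun k hk => (Finset.mem_filter.1 hk).2) (by
      rw [← hxL', ← Real.rpow_add two_pos, ← Real.rpow_natCast 2 n]
      have : (2 : ℝ) * 2 ^ (n : ℝ) = 2 ^ (1 + (n : ℝ)) := by
        rw [Real.rpow_add two_pos, Real.rpow_one]
      rw [this]
      refine Real.rpow_lt_rpow_of_exponent_lt one_lt_two ?_
      linarith)
  by_contra! hcon
  have hxs : 0 < x ^ s := Real.rpow_pos_of_pos hx0 s
  set c := ((Finset.range (2 ^ n)).filter fun k =>
    (2 : ℝ) ^ (-(n * (1 + η))) ≤ ν.real (dyadic n k)).card with hc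
  have hreal : (c : ℝ) ≤ 2 + 3 * x ^ s := by
    have h1 : (c : ℝ≥0∞) ≤ ENNReal.ofReal (2 + 3 * x ^ s) := by
      rw [ENNReal.ofReal_add two_pos.le (by positivity), ENNReal.ofReal_mul (by norm_num)]
      refine hcount.trans ?_
      rw [ENNReal.ofReal_ofNat, ENNReal.ofReal_ofNat]
      gcongr
    rw [← ENNReal.ofReal_natCast] at h1
    exact (ENNReal.ofReal_le_ofReal_iff (by positivity)).1 h1
  have hexp : L * σ - κ ≤ n * (1 - η) := by
    have h1 : (L - 2) * σ < (n + 1) * (1 - η) := by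
      have := mul_lt_mul_of_pos_right hn2 h1η
      rw [hσ]
      calc (L - 2) * ((1 - η) / (2 + η)) = (L - 2) / (2 + η) * (1 - η) := by ring
        _ < _ := this
    rw [hκ]
    linarith
  have hlow : (2 : ℝ) ^ (-κ) * x ^ σ ≤ 2 ^ (n * (1 - η)) := by
    rw [← hxL', ← Real.rpow_mul two_pos.le, ← Real.rpow_add two_pos]
    exact Real.rpow_le_rpow_of_exponent_le one_le_two (by linarith)
  have hone : 1 ≤ x ^ s := Real.one_le_rpow hx1.le (by linarith)
  have hsplit : x ^ σ = x ^ (σ - s) * x ^ s := by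
    rw [← Real.rpow_add hx0]
    congr 1
    ring
  rw [hsplit, ← mul_assoc] at hlow
  have := mul_lt_mul_of_pos_right hx5 hxs
  linarith

theorem eventually_rpow_le_lqSum_of_tendsto {q s : ℝ} (hq : 0 ≤ q)
    (h : Tendsto (fun n : ℕ => lqLevel ν n q) atTop (𝓝 (s : EReal))) {δ : ℝ} (hδ : 0 < δ) :
    ∀ᶠ n : ℕ in atTop, (2 : ℝ) ^ (n * (s - δ)) ≤ lqSum ν n q := by
  have hlt : ((s - δ : ℝ) : EReal) < (s : EReal) := by
    rw [EReal.coe_lt_coe_iff]; linarith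
  filter_upwards [h.eventually_const_lt hlt, eventually_ne_atTop 0] with n hn hn0
  by_contra! hcon
  exact absurd ((lqLevel_le_iff hn0 hq).2 hcon.le) hn.not_ge

end KreinFeller

end

theorem corollary1p4 (ν : Measure ℝ) [IsFiniteMeasure ν] (hν : ν (Ioo (0 : ℝ) 1)ᶜ = 0) :
    (KreinFeller.upperSpectralDim ν = ((1 / 2 : ℝ) : EReal) →
      ∀ q ∈ Icc (0 : ℝ) 1, KreinFeller.lqSpectrum ν q = ((1 - q : ℝ) : EReal)) ∧
    (∀ q ∈ Ioo (0 : ℝ) 1,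
      Tendsto (fun n : ℕ => KreinFeller.lqLevel ν n q) atTop (𝓝 (KreinFeller.lqSpectrum ν q)) →
      KreinFeller.lqSpectrum ν q = ((1 - q : ℝ) : EReal) →
        (∀ p ∈ Icc (0 : ℝ) 1, KreinFeller.lqSpectrum ν p = ((1 - p : ℝ) : EReal)) ∧
        KreinFeller.HasSpectralDim ν ((1 / 2 : ℝ) : EReal)) := by
  refine ⟨fun h p hp => ?_, fun q hq hlim hval => ⟨fun p hp => ?_, ?_⟩⟩
  · by_contra hne
    exact (KreinFeller.upperSpectralDim_lt_half_of_lqSpectrum_ne hp hne).ne h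
  · by_contra hne
    obtain ⟨r, hr, hrate⟩ := KreinFeller.exists_hasLqRate_of_lqSpectrum_ne hp hne
    -- A defect at `p` would propagate to `q`, where the rate is known to be maximal.
    obtain ⟨r', hr', hrate'⟩ := hrate.exists_lt hr hq
    have hle := hrate'.lqSpectrum_le hq.1.le
    rw [hval, EReal.coe_le_coe_iff] at hle
    exact hle.not_gt hr'
  · have hlow : ((1 / 2 : ℝ) : EReal) ≤ KreinFeller.lowerSpectralDim ν :=
      KreinFeller.half_le_lowerSpectralDim hq fun δ hδ =>
        KreinFeller.eventually_rpow_le_lqSum_of_tendsto hq.1.le (hval ▸ hlim) hδ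
    have hup := KreinFeller.upperSpectralDim_le_half (ν := ν)
    have hmid : KreinFeller.lowerSpectralDim ν ≤ KreinFeller.upperSpectralDim ν :=
      liminf_le_limsup
    exact ⟨le_antisymm (hmid.trans hup) hlow, le_antisymm hup (hlow.trans hmid)⟩
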